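/- Let $p>5$ and $\gamma<0$, and put $s_c:=\frac12-\frac{2}{p-1}$. For $f\in H^1(\mathbb R)$ (complex-valued, identified with its continuous representative) and $\beta\in\{\gamma,0\}$ define $$M(f):=\|f\|_{L^2}^2,\qquad E_\beta(f):=\tfrac12\|f'\|_{L^2}^2-\tfrac{\beta}{2}|f(0)|^2-\tfrac1{p+1}\|f\|_{L^{p+1}}^{p+1},\qquad E:=E_0,$$ $$K_\gamma(f):=\|f'\|_{L^2}^2-\tfrac{\gamma}{2}|f(0)|^2-\tfrac{p-1}{2(p+1)}\|f\|_{L^{p+1}}^{p+1},\qquad \|f\|_{\dot H^1_\gamma}^2:=\|f'\|_{L^2}^2+|\gamma||f(0)|^2,\qquad \|f\|_{\dot H^1}:=\|f'\|_{L^2}.$$ For $\omega>0$ let $$Q_{\omega,0}(x):=\{2(p+1)\}^{\frac1{p-1}}\,\omega^{\frac1{p-1}}\Big[2\cosh\Big(\tfrac{p-1}{2}\sqrt\omega\,x\Big)\Big]^{-\frac{2}{p-1}},\qquad Q:=Q_{1,0}.$$ Let $f\in H^1(\mathbb R)$ be even and satisfy $$E_\gamma(f)\,M(f)^{\frac{1-s_c}{s_c}}\le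 2^{\frac1{s_c}}E(Q)\,M(Q)^{\frac{1-s_c}{s_c}}\qquad\text{and}\qquad M(f)\ge 2M(Q_{\gamma^2/4,0}).$$ Then $K_\gamma(f)>0$ if and only if $$\sqrt2\,\|Q\|_{L^2}^{1-s_c}\|Q\|_{\dot H^1}^{s_c}>\|f\|_{L^2}^{1-s_c}\|f\|_{\dot H^1_\gamma}^{s_c}.$$ Moreover, $K_\gamma(f)<0$ if and only if $$\sqrt2\,\|Q\|_{L^2}^{1-s_c}\|Q\|_{\dot H^1}^{s_c}<\|f\|_{L^2}^{1-s_c}\|f\|_{\dot H^1_\gamma}^{s_c}.$$ -/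

import Mathlib

open MeasureTheory

namespace DeltaNLS

/-- `g` is a weak (distributional) derivative of `f` on the real line. -/
def HasWeakDeriv (f g : ℝ → ℂ) : Prop :=
  LocallyIntegrable f volume ∧ LocallyIntegrable g volume ∧
    ∀ φ : ℝ → ℝ, ContDiff ℝ (⊤ : ℕ∞) φ → HasCompactSupport φ →
      ∫ x, deriv φ x • f x = -∫ x, φ x • g x

/-- Weak derivatives are unique up to null sets. -/
theorem HasWeakDeriv.ae_eq {f g h : ℝ → ℂ} (hg : HasWeakDeriv f g) (hh : HasWeakDeriv f h) :
    g =ᵐ[volume] h := by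
  refine ae_eq_of_integral_contDiff_smul_eq hg.2.1 hh.2.1 fun φ hφ hc => ?_
  have h1 := hg.2.2 φ hφ hc
  have h2 := hh.2.2 φ hφ hc
  exact neg_injective (h1.symm.trans h2)

open Classical in
/-- The weak derivative `f'` (determined up to null sets; `0` if there is none). -/
noncomputable def weakDeriv (f : ℝ → ℂ) : ℝ → ℂ :=
  if h : ∃ g, HasWeakDeriv f g then h.choose else 0

theorem HasWeakDeriv.weakDeriv_ae_eq {f g : ℝ → ℂ} (hg : HasWeakDeriv f g) :
    weakDeriv f =ᵐ[volume] g := by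
  have h : ∃ g, HasWeakDeriv f g := ⟨g, hg⟩
  have e : weakDeriv f = h.choose := by simp only [weakDeriv, dif_pos h]
  rw [e]
  exact h.choose_spec.ae_eq hg

/-- `f ∈ H¹(ℝ)`: `f` and its weak derivative lie in `L²(ℝ)`. As usual in dimension one, an element
of `H¹(ℝ)` is identified with its unique continuous representative, so that `f 0` makes sense. -/
def MemH1 (f : ℝ → ℂ) : Prop :=
  Continuous f ∧ MemLp f 2 volume ∧ ∃ g, HasWeakDeriv f g ∧ MemLp g 2 volume

/-- `f ∈ H¹_even(ℝ)`. -/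
def MemH1Even (f : ℝ → ℂ) : Prop :=
  MemH1 f ∧ ∀ x, f (-x) = f x

/-- The norm of `L^q(ℝ)`, for `0 < q < ∞`. -/
noncomputable def normL (q : ℝ) (f : ℝ → ℂ) : ℝ :=
  (eLpNorm f (ENNReal.ofReal q) volume).toReal

/-- The mass `M(f) = ‖f‖_{L²}²`. -/
noncomputable def mass (f : ℝ → ℂ) : ℝ :=
  normL 2 f ^ 2

/-- The energy `E_γ(f)`; the free energy `E` is `E_0`. -/
noncomputable def energy (p γ : ℝ) (f : ℝ → ℂ) : ℝ :=
  1 / 2 * normL 2 (weakDeriv f) ^ 2 - γ / 2 * ‖f 0‖ ^ 2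
    - 1 / (p + 1) * normL (p + 1) f ^ (p + 1)

/-- The virial functional `K_γ(f)`. -/
noncomputable def virial (p γ : ℝ) (f : ℝ → ℂ) : ℝ :=
  normL 2 (weakDeriv f) ^ 2 - γ / 2 * ‖f 0‖ ^ 2
    - (p - 1) / (2 * (p + 1)) * normL (p + 1) f ^ (p + 1)

/-- The norm of `Ḣ¹_γ`, with square `‖f'‖_{L²}² + |γ| |f(0)|²`. -/
noncomputable def normHdot (γ : ℝ) (f : ℝ → ℂ) : ℝ :=
  Real.sqrt (normL 2 (weakDeriv f) ^ 2 + |γ| * ‖f 0‖ ^ 2)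

/-- The scaling critical regularity index `s_c = 1/2 - 2/(p-1)`. -/
noncomputable def sc (p : ℝ) : ℝ :=
  1 / 2 - 2 / (p - 1)

/-- The ground state `Q_{ω,0}` of `-u'' + ω u = |u|^{p-1} u`, for `ω > 0`. -/
noncomputable def groundState (p ω : ℝ) (x : ℝ) : ℂ :=
  (((2 * (p + 1)) ^ (1 / (p - 1)) * ω ^ (1 / (p - 1)) *
    (2 * Real.cosh ((p - 1) / 2 * (Real.sqrt ω * x))) ^ (-(2 / (p - 1))) : ℝ) : ℂ)

/-- The ground state `Q = Q_{1,0}`. -/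
noncomputable def Q (p : ℝ) : ℝ → ℂ :=
  groundState p 1

end DeltaNLS

namespace DeltaNLS

open Filter Topology Set

/-! Put `μ = -γ/2` and choose `ω` so that `Q_{ω,0}` has half the mass of `f`. The mass hypothesis
then says exactly `√ω ≤ μ`. With `D₀ = 2‖Q_{ω,0}'‖²`, scaling turns the energy hypothesis into
`E_γ(f) ≤ s_c D₀` and the comparison of norm products into the comparison of `‖f‖²_{Ḣ¹_γ}` with
`D₀`.

The core is a sharp inequality for even functions with a point term
(`IncrementBound.rpow_mul_integral_lt`): if the mass-preserving rescaling `f_l = √l f(l ·)`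
satisfies `‖f_l‖²_{Ḣ¹_γ} = D₀`, then its `L^{p+1}` integral is strictly below twice that of
`Q_{ω,0}`. Hence `E_γ(f_l) > s_c D₀ ≥ E_γ(f)`. Bernoulli's inequality for the power `l^((p-1)/2)`
bounds `E_γ(f_l) - E_γ(f)` by `(l² - 1)/2 · K_γ(f)`, so `K_γ(f)` has the sign of `l - 1`, which is
that of `D₀ - ‖f‖²_{Ḣ¹_γ}` (`virial_trichotomy`). The case `l = 1` is impossible, so the
implications reverse.

The sharp inequality rests on completing a square. With `W(t) = ω t² - 2/(p+1) t^(p+1)` the soliton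
solves `q'² = W(q)`, and `|u'|² + W(u) ≥ 2 √W(u) |u'|` in general. On a half-line, `u` goes from `u
0` up to its maximum `A` and then down to `0`, which costs at least `4 ∫₀^A √W - 2 ∫₀^{u 0} √W`.
Since `√W(t) < √ω t ≤ μ t`, the point term `μ u(0)²` more than pays for the missing piece
(`IncrementBound.four_mul_integral_sqrt_lt`). If `A` is the peak of the soliton, the two half-lines
together cost more than two whole solitons; an amplitude factor removes this normalization of `A`.
-/

/-! ### Weak derivatives and the fundamental theorem of calculus -/

theorem continuous_deriv_smoothTransition : Continuous (deriv Real.smoothTransition) :=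
  (Real.smoothTransition.contDiff (n := 1)).continuous_deriv le_rfl

theorem deriv_smoothTransition_eq_zero {x : ℝ} (hx : x ∉ Icc (0 : ℝ) 1) :
    deriv Real.smoothTransition x = 0 := by
  simp only [mem_Icc, not_and_or, not_le] at hx
  rcases hx with hx | hx
  · have : Real.smoothTransition =ᶠ[𝓝 x] fun _ => 0 := by
      filter_upwards [Iio_mem_nhds hx] with t ht
      exact Real.smoothTransition.zero_of_nonpos (le_of_lt ht)
    rw [this.deriv_eq, deriv_const]
  · have : Real.smoothTransition =ᶠ[𝓝 x] fun _ => 1 := by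
      filter_upwards [Ioi_mem_nhds hx] with t ht
      exact Real.smoothTransition.one_of_one_le (le_of_lt ht)
    rw [this.deriv_eq, deriv_const]

theorem integral_deriv_smoothTransition :
    ∫ s in (0 : ℝ)..1, deriv Real.smoothTransition s = 1 := by
  rw [intervalIntegral.integral_deriv_eq_sub
    (fun x _ => (Real.smoothTransition.contDiff (n := 1)).differentiable (by norm_num) x)
    (continuous_deriv_smoothTransition.intervalIntegrable _ _)]
  simp

/-- Integrating a continuous function against an approximate delta at `x`. -/
theorem tendsto_integral_deriv_smoothTransition {f : ℝ → ℂ} (hf : Continuous f) (x : ℝ) :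
    Tendsto (fun n : ℕ => ∫ t, (((n : ℝ) + 1) *
      deriv Real.smoothTransition (((n : ℝ) + 1) * (t - x))) • f t) atTop (𝓝 (f x)) := by
  have key : ∀ n : ℕ, ∫ t, (((n : ℝ) + 1) *
      deriv Real.smoothTransition (((n : ℝ) + 1) * (t - x))) • f t =
      ∫ s in (0 : ℝ)..1, deriv Real.smoothTransition s • f (x + s * (1 / ((n : ℝ) + 1))) := by
    intro n
    have hn : (0 : ℝ) < (n : ℝ) + 1 := by positivity
    have e1 : ∀ t, (((n : ℝ) + 1) *
        deriv Real.smoothTransition (((n : ℝ) + 1) * (t - x))) • f t =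
        (fun r => (fun s => (((n : ℝ) + 1) * deriv Real.smoothTransition s) •
          f (x + s * (1 / ((n : ℝ) + 1)))) (((n : ℝ) + 1) * r)) (t - x) := by
      intro t
      have : x + ((n : ℝ) + 1) * (t - x) * (1 / ((n : ℝ) + 1)) = t := by field_simp; ring
      simp only [this]
    simp_rw [e1]
    rw [integral_sub_right_eq_self (fun r => (fun s => (((n : ℝ) + 1) *
      deriv Real.smoothTransition s) • f (x + s * (1 / ((n : ℝ) + 1)))) (((n : ℝ) + 1) * r)) x,
      Measure.integral_comp_mul_left (fun s => (((n : ℝ) + 1) *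
      deriv Real.smoothTransition s) • f (x + s * (1 / ((n : ℝ) + 1)))) ((n : ℝ) + 1),
      abs_of_pos (inv_pos.2 hn)]
    simp_rw [mul_smul]
    rw [integral_smul, smul_smul, inv_mul_cancel₀ hn.ne', one_smul,
      intervalIntegral.integral_of_le zero_le_one, ← integral_Icc_eq_integral_Ioc,
      setIntegral_eq_integral_of_forall_compl_eq_zero]
    intro s hs
    rw [deriv_smoothTransition_eq_zero hs, zero_smul]
  simp_rw [key]
  have hc : Continuous fun h : ℝ => ∫ s in (0 : ℝ)..1,
      deriv Real.smoothTransition s • f (x + s * h) := by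
    apply intervalIntegral.continuous_parametric_intervalIntegral_of_continuous'
    have := continuous_deriv_smoothTransition
    fun_prop
  have h0 : ∫ s in (0 : ℝ)..1, deriv Real.smoothTransition s • f (x + s * 0) = f x := by
    simp only [mul_zero, add_zero]
    rw [intervalIntegral.integral_smul_const, integral_deriv_smoothTransition, one_smul]
  have := (hc.tendsto 0).comp (tendsto_one_div_add_atTop_nhds_zero_nat (𝕜 := ℝ))
  rw [h0] at this
  exact this

/-- Test against smooth plateaus that converge to the indicator of `(x, y]`. Their derivatives are
differences of approximate deltas at `x` and `y`, so continuity of `f` gives one limit and dominated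
convergence the other. -/
theorem HasWeakDeriv.sub_eq_integral {f g : ℝ → ℂ} (h : HasWeakDeriv f g) (hf : Continuous f)
    {x y : ℝ} (hxy : x ≤ y) : f y - f x = ∫ t in x..y, g t := by
  set S := Real.smoothTransition with hS
  -- Both steps have width `1/(n+1) ≤ 1`, so every `φ n` is supported in `[x, y + 1]`.
  set φ : ℕ → ℝ → ℝ := fun n t => S (((n : ℝ) + 1) * (t - x)) - S (((n : ℝ) + 1) * (t - y))
    with hφ
  have hSd : Differentiable ℝ S :=
    (Real.smoothTransition.contDiff (n := 1)).differentiable (by norm_num)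
  have hsm : ∀ n, ContDiff ℝ (⊤ : ℕ∞) (φ n) := fun n =>
    (Real.smoothTransition.contDiff.comp (by fun_prop)).sub
      (Real.smoothTransition.contDiff.comp (by fun_prop))
  have hz : ∀ n t, t ∉ Icc x (y + 1) → φ n t = 0 := by
    intro n t ht
    have hn : (1 : ℝ) ≤ (n : ℝ) + 1 := by simp
    simp only [mem_Icc, not_and_or, not_le] at ht
    simp only [hφ]
    rcases ht with ht | ht
    · rw [hS, Real.smoothTransition.zero_of_nonpos, Real.smoothTransition.zero_of_nonpos, sub_zero]
      all_goals nlinarith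
    · rw [hS, Real.smoothTransition.one_of_one_le, Real.smoothTransition.one_of_one_le, sub_self]
      all_goals nlinarith
  have hcs : ∀ n, HasCompactSupport (φ n) := fun n =>
    HasCompactSupport.intro isCompact_Icc (fun t ht => hz n t ht)
  have hder : ∀ (n : ℕ) (a t : ℝ), HasDerivAt (fun t => S (((n : ℝ) + 1) * (t - a)))
      (((n : ℝ) + 1) * deriv S (((n : ℝ) + 1) * (t - a))) t := by
    intro n a t
    have h1 : HasDerivAt (fun t : ℝ => ((n : ℝ) + 1) * (t - a)) ((n : ℝ) + 1) t := by
      simpa using ((hasDerivAt_id t).sub_const a).const_mul ((n : ℝ) + 1)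
    have := (hSd (((n : ℝ) + 1) * (t - a))).hasDerivAt.comp t h1
    rwa [mul_comm] at this
  have hint : ∀ (n : ℕ) (a : ℝ), Integrable (fun t => (((n : ℝ) + 1) *
      deriv S (((n : ℝ) + 1) * (t - a))) • f t) := by
    intro n a
    have := continuous_deriv_smoothTransition
    refine Continuous.integrable_of_hasCompactSupport (by fun_prop) ?_
    refine HasCompactSupport.intro (isCompact_Icc (a := a) (b := a + 1)) fun t ht => ?_
    rw [deriv_smoothTransition_eq_zero, mul_zero, zero_smul]
    intro hm
    have hn : (1 : ℝ) ≤ (n : ℝ) + 1 := by simp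
    apply ht
    constructor
    · by_contra hc
      nlinarith [hm.1]
    · by_contra hc
      nlinarith [hm.2]
  have hleft : Tendsto (fun n => ∫ t, deriv (φ n) t • f t) atTop (𝓝 (f x - f y)) := by
    refine ((tendsto_integral_deriv_smoothTransition hf x).sub
      (tendsto_integral_deriv_smoothTransition hf y)).congr fun n => ?_
    rw [← integral_sub (hint n x) (hint n y)]
    congr 1
    ext1 t
    rw [← sub_smul, ← ((hder n x t).sub (hder n y t)).deriv]
    rfl
  have hright : Tendsto (fun n => ∫ t, φ n t • g t) atTop (𝓝 (∫ t in x..y, g t)) := by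
    rw [intervalIntegral.integral_of_le hxy, ← integral_indicator measurableSet_Ioc]
    refine tendsto_integral_of_dominated_convergence
      ((Icc x (y + 1)).indicator fun t => ‖g t‖) ?_ ?_ ?_ ?_
    · exact fun n => (hsm n).continuous.aestronglyMeasurable.smul h.2.1.aestronglyMeasurable
    · exact (integrable_indicator_iff measurableSet_Icc).2
        (h.2.1.integrableOn_isCompact isCompact_Icc).norm
    · refine fun n => Eventually.of_forall fun t => ?_
      by_cases ht : t ∈ Icc x (y + 1)
      · rw [indicator_of_mem ht, norm_smul]
        refine mul_le_of_le_one_left (norm_nonneg _) ?_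
        rw [Real.norm_eq_abs, abs_le]
        have := Real.smoothTransition.nonneg (((n : ℝ) + 1) * (t - x))
        have := Real.smoothTransition.nonneg (((n : ℝ) + 1) * (t - y))
        have := Real.smoothTransition.le_one (((n : ℝ) + 1) * (t - x))
        have := Real.smoothTransition.le_one (((n : ℝ) + 1) * (t - y))
        constructor <;> simp only [hφ, hS] <;> linarith
      · rw [indicator_of_notMem ht, hz n t ht, zero_smul, norm_zero]
    · refine Eventually.of_forall fun t => ?_
      have hstep : ∀ a, a < t → ∀ᶠ n : ℕ in atTop, S (((n : ℝ) + 1) * (t - a)) = 1 := by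
        intro a ha
        have : Tendsto (fun n : ℕ => ((n : ℝ) + 1) * (t - a)) atTop atTop :=
          (tendsto_atTop_add_const_right _ _ tendsto_natCast_atTop_atTop).atTop_mul_const
            (sub_pos.2 ha)
        filter_upwards [this.eventually_ge_atTop 1] with n hn
        exact Real.smoothTransition.one_of_one_le hn
      have hstep0 : ∀ a, t ≤ a → ∀ n : ℕ, S (((n : ℝ) + 1) * (t - a)) = 0 := by
        intro a ha n
        refine Real.smoothTransition.zero_of_nonpos ?_
        have hn : (0 : ℝ) ≤ (n : ℝ) + 1 := by positivity
        nlinarith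
      refine tendsto_const_nhds.congr' ?_
      rcases le_or_gt t x with h1 | h1
      · refine Eventually.of_forall fun n => ?_
        simp only [hφ]
        rw [hstep0 x h1, hstep0 y (h1.trans hxy), sub_self, zero_smul, indicator_of_notMem]
        exact fun hm => not_lt.2 h1 hm.1
      · rcases le_or_gt t y with h2 | h2
        · filter_upwards [hstep x h1] with n hn
          simp only [hφ]
          rw [hstep0 y h2, hn, sub_zero, one_smul, indicator_of_mem (show t ∈ Ioc x y from ⟨h1, h2⟩)]
        · filter_upwards [hstep x h1, hstep y h2] with n hn hn'
          simp only [hφ]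
          rw [hn, hn', sub_self, zero_smul, indicator_of_notMem]
          exact fun hm => not_lt.2 hm.2 h2
  have heq : (fun n => ∫ t, deriv (φ n) t • f t) = fun n => -∫ t, φ n t • g t := by
    ext1 n
    exact h.2.2 (φ n) (hsm n) (hcs n)
  rw [heq] at hleft
  have := tendsto_nhds_unique hleft hright.neg
  rw [← neg_sub, this, neg_neg]

theorem HasWeakDeriv.abs_norm_sub_norm_le {f g : ℝ → ℂ} (h : HasWeakDeriv f g)
    (hf : Continuous f) {x y : ℝ} (hxy : x ≤ y) : |‖f y‖ - ‖f x‖| ≤ ∫ t in x..y, ‖g t‖ := by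
  refine (_root_.abs_norm_sub_norm_le _ _).trans ?_
  rw [h.sub_eq_integral hf hxy]
  exact intervalIntegral.norm_integral_le_integral_norm hxy

/-! ### Functions with square integrable increment density -/

/-- `u ≥ 0` is a continuous `L²` function whose increments are controlled by the `L²` density
`k ≥ 0`. -/
structure IncrementBound (u k : ℝ → ℝ) : Prop where
  cont : Continuous u
  u_nonneg : ∀ x, 0 ≤ u x
  k_nonneg : ∀ x, 0 ≤ k x
  u_sq : Integrable fun x => u x ^ 2
  k_sq : Integrable fun x => k x ^ 2
  k_loc : LocallyIntegrable k
  bound : ∀ x y, x ≤ y → |u y - u x| ≤ ∫ t in x..y, k t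

namespace IncrementBound

variable {u k : ℝ → ℝ}

theorem k_intervalIntegrable (h : IncrementBound u k) (x y : ℝ) :
    IntervalIntegrable k volume x y :=
  (h.k_loc.integrableOn_isCompact isCompact_uIcc).intervalIntegrable

theorem mul_intervalIntegrable (h : IncrementBound u k) {w : ℝ → ℝ} (hw : Continuous w)
    (x y : ℝ) : IntervalIntegrable (fun t => w (u t) * k t) volume x y :=
  (h.k_intervalIntegrable x y).continuousOn_mul (hw.comp h.cont).continuousOn

/-- A chain rule in the form of an inequality, with no differentiability of `u`. The mean value
theorem gives it on short intervals up to an error `ε ∫ k`, and continuous induction along `[x, y]`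
propagates it. -/
theorem comp_sub_le (h : IncrementBound u k) {F v w : ℝ → ℝ} (hF : ∀ s, HasDerivAt F (v s) s)
    (hvw : ∀ s, |v s| ≤ w s) (hw : Continuous w) {x y : ℝ} (hxy : x ≤ y) :
    F (u y) - F (u x) ≤ ∫ t in x..y, w (u t) * k t := by
  have hFc : Continuous F := continuous_iff_continuousAt.2 fun s => (hF s).continuousAt
  have hi := h.mul_intervalIntegrable hw
  have hprim : ∀ f : ℝ → ℝ, (∀ a b, IntervalIntegrable f volume a b) →
      Continuous fun t => ∫ r in x..t, f r := fun f hf =>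
    intervalIntegral.continuous_primitive hf x
  have key : ∀ ε > 0, F (u y) - F (u x) ≤ ∫ t in x..y, (w (u t) * k t + ε * k t) := by
    intro ε hε
    have hi2 : ∀ a b, IntervalIntegrable (fun t => w (u t) * k t + ε * k t) volume a b :=
      fun a b => (hi a b).add ((h.k_intervalIntegrable a b).const_mul ε)
    set s : Set ℝ := {t | F (u t) - F (u x) ≤ ∫ r in x..t, (w (u r) * k r + ε * k r)} with hs
    have hclosed : IsClosed s :=
      isClosed_le ((hFc.comp h.cont).sub continuous_const) (hprim _ hi2)
    have hmem : Icc x y ⊆ s := by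
      refine (hclosed.inter isClosed_Icc).Icc_subset_of_forall_exists_gt ?_ ?_
      · simp [hs]
      · rintro t ⟨hts, -⟩ z hz
        have hcw : ContinuousAt (fun r => w (u r)) t := (hw.comp h.cont).continuousAt
        obtain ⟨δ, hδ, hδ'⟩ := Metric.continuousAt_iff.1 hcw (ε / 2) (by positivity)
        set r := min z (t + δ / 2) with hr
        have htr : t < r := lt_min hz (by linarith)
        have hrδ : r ≤ t + δ / 2 := min_le_right _ _
        refine ⟨r, ?_, htr, min_le_left _ _⟩
        have hnear : ∀ q ∈ Icc t r, |w (u q) - w (u t)| < ε / 2 := by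
          intro q hq
          have := @hδ' q (by rw [Real.dist_eq, abs_of_nonneg (by linarith [hq.1])]; linarith [hq.2])
          rwa [Real.dist_eq] at this
        -- mean value along the segment between `u t` and `u r`
        have hmv : F (u r) - F (u t) ≤ (w (u t) + ε / 2) * |u r - u t| := by
          have hval : ∀ q ∈ uIcc (u t) (u r), ‖v q‖ ≤ w (u t) + ε / 2 := by
            intro q hq
            obtain ⟨a, ha, rfl⟩ := intermediate_value_uIcc (f := u) (a := t) (b := r)
              h.cont.continuousOn hq
            rw [uIcc_of_le htr.le] at ha
            have := (abs_lt.1 (hnear a ha)).2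
            rw [Real.norm_eq_abs]
            linarith [hvw (u a)]
          have := Convex.norm_image_sub_le_of_norm_hasDerivWithin_le
            (f := F) (f' := v) (s := uIcc (u t) (u r)) (x := u t) (y := u r)
            (fun q _ => (hF q).hasDerivWithinAt) hval (convex_uIcc _ _) left_mem_uIcc right_mem_uIcc
          exact (le_abs_self _).trans this
        have hw0 : 0 ≤ w (u t) := (abs_nonneg _).trans (hvw _)
        have hstep : F (u r) - F (u t) ≤ ∫ q in t..r, (w (u q) * k q + ε * k q) := by
          refine hmv.trans ((mul_le_mul_of_nonneg_left (h.bound t r htr.le) (by positivity)).trans ?_)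
          rw [← intervalIntegral.integral_const_mul]
          refine intervalIntegral.integral_mono_on htr.le
            ((h.k_intervalIntegrable t r).const_mul _) (hi2 t r) fun q hq => ?_
          have := (abs_lt.1 (hnear q hq)).1
          nlinarith [h.k_nonneg q]
        have hsplit := intervalIntegral.integral_add_adjacent_intervals (hi2 x t) (hi2 t r)
        show F (u r) - F (u x) ≤ _
        have hts' : F (u t) - F (u x) ≤ ∫ r in x..t, (w (u r) * k r + ε * k r) := hts
        linarith
    exact hmem (right_mem_Icc.2 hxy)
  have hk0 : 0 ≤ ∫ t in x..y, k t := (abs_nonneg _).trans (h.bound x y hxy)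
  refine le_of_forall_pos_le_add fun ε hε => ?_
  -- The `1 +` keeps the denominator positive when `∫ k = 0`.
  have := key (ε / (1 + ∫ t in x..y, k t)) (by positivity)
  rw [intervalIntegral.integral_add (hi x y) ((h.k_intervalIntegrable x y).const_mul _),
    intervalIntegral.integral_const_mul] at this
  have h2 : ε / (1 + ∫ t in x..y, k t) * ∫ t in x..y, k t ≤ ε := by
    rw [div_mul_eq_mul_div, div_le_iff₀ (by positivity)]
    nlinarith
  linarith

/-- A drop of `u²` costs at most `∫ 2uk ≤ ∫ (u² + k²)`. So `u x ^ 2` is at most the tail of that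
integral; otherwise `u²` would stay above a positive constant on `(x, ∞)` and not be integrable. -/
theorem tendsto_zero (h : IncrementBound u k) : Tendsto u atTop (𝓝 0) := by
  have hint : Integrable fun t => u t ^ 2 + k t ^ 2 := h.u_sq.add h.k_sq
  have hsq : ∀ x y, x ≤ y → u x ^ 2 ≤ u y ^ 2 + ∫ t in Ioi x, (u t ^ 2 + k t ^ 2) := by
    intro x y hxy
    have h1 := h.comp_sub_le (F := fun s => -s ^ 2) (v := fun s => -(2 * s)) (w := fun s => 2 * |s|)
      (fun s => by simpa using! (hasDerivAt_pow 2 s).neg) (fun s => by simp [abs_mul])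
      (by fun_prop) hxy
    have h2 : ∫ t in x..y, 2 * |u t| * k t ≤ ∫ t in x..y, (u t ^ 2 + k t ^ 2) := by
      refine intervalIntegral.integral_mono_on hxy
        (h.mul_intervalIntegrable (w := fun s => 2 * |s|) (by fun_prop) x y)
        hint.intervalIntegrable fun t _ => ?_
      rw [abs_of_nonneg (h.u_nonneg t)]
      nlinarith [sq_nonneg (u t - k t)]
    have h3 : ∫ t in x..y, (u t ^ 2 + k t ^ 2) ≤ ∫ t in Ioi x, (u t ^ 2 + k t ^ 2) := by
      rw [intervalIntegral.integral_of_le hxy]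
      exact setIntegral_mono_set hint.integrableOn
        (Eventually.of_forall fun t => by positivity) Ioc_subset_Ioi_self.eventuallyLE
    linarith
  have hsmall : ∀ x, u x ^ 2 ≤ ∫ t in Ioi x, (u t ^ 2 + k t ^ 2) := by
    intro x
    by_contra hc
    push Not at hc
    set c := u x ^ 2 - ∫ t in Ioi x, (u t ^ 2 + k t ^ 2) with hcdef
    have hc0 : 0 < c := sub_pos.2 hc
    have hge : ∀ y ∈ Ioi x, c ≤ u y ^ 2 := fun y hy => by
      have := hsq x y (le_of_lt hy)
      linarith
    have : IntegrableOn (fun _ : ℝ => c) (Ioi x) := by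
      refine Integrable.mono' (h.u_sq.integrableOn (s := Ioi x)) aestronglyMeasurable_const ?_
      filter_upwards [ae_restrict_mem measurableSet_Ioi] with y hy
      rw [Real.norm_eq_abs, abs_of_pos hc0]
      exact hge y hy
    rw [integrableOn_const_iff, Real.volume_Ioi] at this
    exact this.elim (by simpa using hc0.ne') (lt_irrefl _)
  have hlim : Tendsto (fun x => ∫ t in Ioi x, (u t ^ 2 + k t ^ 2)) atTop (𝓝 0) := by
    have h0 := intervalIntegral_tendsto_integral_Ioi 0 (hint.integrableOn (s := Ioi 0)) tendsto_id
    have : ∀ x : ℝ, ∫ t in Ioi x, (u t ^ 2 + k t ^ 2) =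
        (∫ t in Ioi 0, (u t ^ 2 + k t ^ 2)) - ∫ t in (0 : ℝ)..x, (u t ^ 2 + k t ^ 2) := by
      intro x
      rw [← intervalIntegral.integral_Ioi_sub_Ioi' hint.integrableOn hint.integrableOn]
      ring
    rw [funext this]
    have h1 := (tendsto_const_nhds (x := ∫ t in Ioi (0 : ℝ), (u t ^ 2 + k t ^ 2))).sub h0
    rw [sub_self] at h1
    exact h1
  have hs : Tendsto (fun x => u x ^ 2) atTop (𝓝 0) :=
    squeeze_zero (fun x => by positivity) hsmall hlim
  have := (Real.continuous_sqrt.tendsto 0).comp hs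
  simpa [Function.comp_def, Real.sqrt_sq (h.u_nonneg _)] using this

theorem exists_max (h : IncrementBound u k) (hne : ∃ x, 0 ≤ x ∧ 0 < u x) :
    ∃ x₀, 0 ≤ x₀ ∧ 0 < u x₀ ∧ ∀ x, 0 ≤ x → u x ≤ u x₀ := by
  obtain ⟨a, ha, hua⟩ := hne
  obtain ⟨b, hb⟩ := (eventually_atTop.1 (h.tendsto_zero.eventually_lt_const hua))
  obtain ⟨x₀, hx₀, hmax⟩ := (isCompact_Icc (a := (0 : ℝ)) (b := max a b)).exists_isMaxOn
    ⟨0, by simp [ha]⟩ h.cont.continuousOn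
  have h1 : u a ≤ u x₀ := hmax (show a ∈ Icc 0 (max a b) from ⟨ha, le_max_left _ _⟩)
  refine ⟨x₀, hx₀.1, hua.trans_le h1, fun x hx => ?_⟩
  rcases le_or_gt x (max a b) with hx' | hx'
  · exact hmax (show x ∈ Icc 0 (max a b) from ⟨hx, hx'⟩)
  · exact (hb x ((le_max_right _ _).trans hx'.le)).le.trans h1

theorem scale (h : IncrementBound u k) {α l : ℝ} (hα : 0 < α) (hl : 0 < l) :
    IncrementBound (fun x => α * u (l * x)) fun x => α * l * k (l * x) where
  cont := by have := h.cont; fun_prop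
  u_nonneg x := mul_nonneg hα.le (h.u_nonneg _)
  k_nonneg x := mul_nonneg (by positivity) (h.k_nonneg _)
  u_sq := by
    simp_rw [mul_pow]
    exact (h.u_sq.comp_mul_left' hl.ne').const_mul _
  k_sq := by
    simp_rw [mul_pow]
    exact (h.k_sq.comp_mul_left' hl.ne').const_mul _
  k_loc := by
    refine (locallyIntegrable_iff.2 fun K hK => ?_)
    obtain ⟨a, b, hab⟩ : ∃ a b : ℝ, K ⊆ Icc a b :=
      ⟨_, _, hK.isBounded.subset_Icc_sInf_sSup⟩
    refine IntegrableOn.mono_set ?_ (hab.trans (Icc_subset_Icc_right (le_max_right a b)))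
    rw [integrableOn_Icc_iff_integrableOn_Ioc,
      ← intervalIntegrable_iff_integrableOn_Ioc_of_le (le_max_left a b)]
    have := (h.k_intervalIntegrable (l * a) (l * (max a b))).comp_mul_left (c := l)
    rw [mul_div_cancel_left₀ _ hl.ne', mul_div_cancel_left₀ _ hl.ne'] at this
    exact this.const_mul _
  bound x y hxy := by
    rw [← mul_sub, abs_mul, abs_of_pos hα, intervalIntegral.integral_const_mul,
      intervalIntegral.integral_comp_mul_left _ hl.ne', smul_eq_mul, mul_assoc,
      mul_inv_cancel_left₀ hl.ne']
    exact mul_le_mul_of_nonneg_left (h.bound _ _ (by nlinarith)) hα.le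

theorem comp_neg (h : IncrementBound u k) : IncrementBound (fun x => u (-x)) fun x => k (-x) where
  cont := by have := h.cont; fun_prop
  u_nonneg x := h.u_nonneg _
  k_nonneg x := h.k_nonneg _
  u_sq := h.u_sq.comp_neg
  k_sq := h.k_sq.comp_neg
  k_loc := by
    refine (locallyIntegrable_iff.2 fun K hK => ?_)
    obtain ⟨a, b, hab⟩ : ∃ a b : ℝ, K ⊆ Icc a b :=
      ⟨_, _, hK.isBounded.subset_Icc_sInf_sSup⟩
    refine IntegrableOn.mono_set ?_ (hab.trans (Icc_subset_Icc_right (le_max_right a b)))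
    rw [integrableOn_Icc_iff_integrableOn_Ioc,
      ← intervalIntegrable_iff_integrableOn_Ioc_of_le (le_max_left a b)]
    have := (h.k_intervalIntegrable (-a) (-(max a b))).comp_mul_left (c := -1)
    simpa using this
  bound x y hxy := by
    rw [intervalIntegral.integral_comp_neg, abs_sub_comm]
    exact h.bound _ _ (by linarith)

end IncrementBound

/-! ### The Robin energy on a half-line -/

theorem hasDerivAt_integral_sqrt {W : ℝ → ℝ} (hW : Continuous W) (s : ℝ) :
    HasDerivAt (fun s => ∫ t in (0 : ℝ)..s, √(W t)) (√(W s)) s :=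
  ((Real.continuous_sqrt.comp hW).integral_hasStrictDerivAt 0 s).hasDerivAt

/-- Applied with `b = u 0`: the part of the square-completion bound missing near the origin is
strictly smaller than the Robin term. -/
theorem two_mul_integral_sqrt_lt {W : ℝ → ℝ} (hW : Continuous W) {c b : ℝ} (hc : 0 < c)
    (hlt : ∀ t, 0 < t → W t < c ^ 2 * t ^ 2) (hb : 0 < b) :
    2 * ∫ t in (0 : ℝ)..b, √(W t) < c * b ^ 2 := by
  have hs : ∀ t, 0 < t → √(W t) < c * t := fun t ht => by
    rw [Real.sqrt_lt' (by positivity), mul_pow]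
    exact hlt t ht
  have h1 : ∫ t in (0 : ℝ)..b, √(W t) < ∫ t in (0 : ℝ)..b, c * t :=
    intervalIntegral.integral_lt_integral_of_continuousOn_of_le_of_exists_lt hb
      (Real.continuous_sqrt.comp hW).continuousOn (by fun_prop)
      (fun t ht => (hs t ht.1).le) ⟨b, right_mem_Icc.2 hb.le, hs b hb⟩
  rw [intervalIntegral.integral_const_mul, integral_id] at h1
  linarith

/-- An integral form of Grönwall's lemma with zero initial data. -/
theorem nonpos_of_le_mul_integral {u : ℝ → ℝ} (hu : Continuous u) {c x₀ : ℝ} (hc : 0 ≤ c)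
    (hx₀ : 0 ≤ x₀) (h : ∀ x ∈ Icc 0 x₀, u x ≤ c * ∫ t in (0 : ℝ)..x, u t) : u x₀ ≤ 0 := by
  have hd : ∀ x, HasDerivAt (fun x => Real.exp (-(c * x)) * ∫ t in (0 : ℝ)..x, u t)
      (Real.exp (-(c * x)) * (u x - c * ∫ t in (0 : ℝ)..x, u t)) x := by
    intro x
    have h1 : HasDerivAt (fun x => Real.exp (-(c * x))) (Real.exp (-(c * x)) * (-c)) x := by
      have : HasDerivAt (fun x => -(c * x)) (-c) x := by
        simpa using! ((hasDerivAt_id x).const_mul c).neg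
      exact this.exp
    refine (h1.mul (hu.integral_hasStrictDerivAt 0 x).hasDerivAt).congr_deriv ?_
    ring
  have hanti : AntitoneOn (fun x => Real.exp (-(c * x)) * ∫ t in (0 : ℝ)..x, u t) (Icc 0 x₀) := by
    refine antitoneOn_of_deriv_nonpos (convex_Icc _ _)
      (fun x _ => (hd x).continuousAt.continuousWithinAt)
      (fun x _ => (hd x).differentiableAt.differentiableWithinAt) fun x hx => ?_
    rw [interior_Icc] at hx
    rw [(hd x).deriv]
    exact mul_nonpos_of_nonneg_of_nonpos (Real.exp_pos _).le
      (sub_nonpos.2 (h x (Ioo_subset_Icc_self hx)))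
  have h2 := hanti (left_mem_Icc.2 hx₀) (right_mem_Icc.2 hx₀) hx₀
  simp only [intervalIntegral.integral_same, mul_zero] at h2
  have h3 : ∫ t in (0 : ℝ)..x₀, u t ≤ 0 := nonpos_of_mul_nonpos_right h2 (Real.exp_pos _)
  exact (h x₀ (right_mem_Icc.2 hx₀)).trans (mul_nonpos_of_nonneg_of_nonpos hc h3)

namespace IncrementBound

variable {u k : ℝ → ℝ}

/-- A lower bound for a Robin energy on the half-line, in terms of the maximum `u x₀`. -/
theorem four_mul_integral_sqrt_lt (h : IncrementBound u k) {W : ℝ → ℝ} (hWc : Continuous W)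
    {c μ x₀ : ℝ} (hc : 0 < c) (hμ : c ≤ μ) (hx₀ : 0 ≤ x₀) (hpos : 0 < u x₀)
    (hmax : ∀ x, 0 ≤ x → u x ≤ u x₀) (hW0 : ∀ t, 0 ≤ t → t ≤ u x₀ → 0 ≤ W t)
    (hlt : ∀ t, 0 < t → W t < c ^ 2 * t ^ 2) (hint : IntegrableOn (fun t => W (u t)) (Ioi 0)) :
    4 * ∫ t in (0 : ℝ)..(u x₀), √(W t) <
      (∫ t in Ioi (0 : ℝ), (k t ^ 2 + W (u t))) + μ * u 0 ^ 2 := by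
  set F : ℝ → ℝ := fun s => ∫ t in (0 : ℝ)..s, √(W t) with hF
  have hFd : ∀ s, HasDerivAt F (√(W s)) s := hasDerivAt_integral_sqrt hWc
  have hF0 : F 0 = 0 := by simp [hF]
  have hFc : Continuous F := continuous_iff_continuousAt.2 fun s => (hFd s).continuousAt
  have hwc : Continuous fun s => √(W s) := Real.continuous_sqrt.comp hWc
  have hwk := h.mul_intervalIntegrable hwc
  have hI : IntegrableOn (fun t => k t ^ 2 + W (u t)) (Ioi 0) := h.k_sq.integrableOn.add hint
  have hsqW : ∀ t, 0 ≤ t → √(W (u t)) ^ 2 = W (u t) := fun t ht =>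
    Real.sq_sqrt (hW0 _ (h.u_nonneg t) (hmax t ht))
  have hIi : ∀ x y, 0 ≤ x → x ≤ y →
      IntervalIntegrable (fun t => k t ^ 2 + W (u t)) volume x y := fun x y hx hxy => by
    rw [intervalIntegrable_iff_integrableOn_Ioc_of_le hxy]
    exact hI.mono_set (Ioc_subset_Ioi_self.trans (Ioi_subset_Ioi hx))
  have hnn : ∀ t, 0 ≤ t → 0 ≤ k t ^ 2 + W (u t) := fun t ht => by
    rw [← hsqW t ht]; positivity
  -- Descent from the maximum to the value `0` at infinity.
  have htail : 2 * F (u x₀) ≤ ∫ t in Ioi x₀, (k t ^ 2 + W (u t)) := by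
    have hy : ∀ y, x₀ ≤ y → 2 * (F (u x₀) - F (u y)) ≤ ∫ t in Ioi x₀, (k t ^ 2 + W (u t)) := by
      intro y hy
      have h1 := h.comp_sub_le (F := fun s => -F s) (v := fun s => -√(W s)) (w := fun s => √(W s))
        (fun s => (hFd s).neg) (fun s => by rw [abs_neg, abs_of_nonneg (Real.sqrt_nonneg _)])
        hwc hy
      have h2 : ∫ t in x₀..y, 2 * (√(W (u t)) * k t) ≤ ∫ t in x₀..y, (k t ^ 2 + W (u t)) := by
        refine intervalIntegral.integral_mono_on hy ((hwk x₀ y).const_mul 2)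
          (hIi x₀ y hx₀ hy) fun t ht => ?_
        have := hsqW t (hx₀.trans ht.1)
        nlinarith [sq_nonneg (√(W (u t)) - k t)]
      have h3 : ∫ t in x₀..y, (k t ^ 2 + W (u t)) ≤ ∫ t in Ioi x₀, (k t ^ 2 + W (u t)) := by
        rw [intervalIntegral.integral_of_le hy]
        refine setIntegral_mono_set (hI.mono_set (Ioi_subset_Ioi hx₀)) ?_
          Ioc_subset_Ioi_self.eventuallyLE
        filter_upwards [ae_restrict_mem measurableSet_Ioi] with t ht
        exact hnn t (hx₀.trans (le_of_lt ht))
      rw [intervalIntegral.integral_const_mul] at h2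
      linarith
    have hlim : Tendsto (fun y => 2 * (F (u x₀) - F (u y))) atTop (𝓝 (2 * (F (u x₀) - F 0))) :=
      (tendsto_const_nhds.sub ((hFc.tendsto 0).comp h.tendsto_zero)).const_mul 2
    rw [hF0, sub_zero] at hlim
    refine le_of_tendsto hlim ?_
    filter_upwards [eventually_ge_atTop x₀] with y using hy y
  have hhead := h.comp_sub_le (F := F) (v := fun s => √(W s)) (w := fun s => √(W s)) hFd
    (fun s => by rw [abs_of_nonneg (Real.sqrt_nonneg _)]) hwc hx₀
  have hsplit : ∫ t in Ioi (0 : ℝ), (k t ^ 2 + W (u t)) =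
      (∫ t in (0 : ℝ)..x₀, (k t ^ 2 + W (u t))) + ∫ t in Ioi x₀, (k t ^ 2 + W (u t)) := by
    rw [← intervalIntegral.integral_Ioi_sub_Ioi hI hx₀]
    ring
  have hsqi : IntervalIntegrable (fun t => (k t - √(W (u t))) ^ 2) volume 0 x₀ := by
    refine ((hIi 0 x₀ le_rfl hx₀).sub ((hwk 0 x₀).const_mul 2)).congr ?_
    intro t ht
    rw [uIoc_of_le hx₀] at ht
    have := hsqW t ht.1.le
    linear_combination -this
  -- On the ascent the square is kept rather than dropped, to settle strictness below.
  have hexp : ∫ t in (0 : ℝ)..x₀, (k t ^ 2 + W (u t)) =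
      (∫ t in (0 : ℝ)..x₀, (k t - √(W (u t))) ^ 2) +
        2 * ∫ t in (0 : ℝ)..x₀, √(W (u t)) * k t := by
    rw [← intervalIntegral.integral_const_mul,
      ← intervalIntegral.integral_add hsqi ((hwk 0 x₀).const_mul 2)]
    refine intervalIntegral.integral_congr fun t ht => ?_
    rw [uIcc_of_le hx₀] at ht
    have := hsqW t ht.1
    linear_combination -this
  have hsq0 : 0 ≤ ∫ t in (0 : ℝ)..x₀, (k t - √(W (u t))) ^ 2 :=
    intervalIntegral.integral_nonneg hx₀ fun t _ => sq_nonneg _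
  by_contra hcon
  push Not at hcon
  -- Strictness: for `u 0 > 0` the Robin term already wins strictly, so only a vanishing value at
  -- the origin remains.
  have hb : u 0 = 0 := by
    by_contra hb
    have hb' : 0 < u 0 := lt_of_le_of_ne (h.u_nonneg 0) (Ne.symm hb)
    have h1 : 2 * F (u 0) < c * u 0 ^ 2 := two_mul_integral_sqrt_lt hWc hc hlt hb'
    have h2 : c * u 0 ^ 2 ≤ μ * u 0 ^ 2 := mul_le_mul_of_nonneg_right hμ (sq_nonneg _)
    have h3 : 4 * F (u x₀) ≥ _ := hcon
    linarith
  rw [hb, hF0] at hhead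
  have hzero : ∫ t in (0 : ℝ)..x₀, (k t - √(W (u t))) ^ 2 = 0 := by
    refine le_antisymm ?_ hsq0
    have h3 : 4 * F (u x₀) ≥ _ := hcon
    rw [hb] at h3
    linarith
  have hae : ∀ᵐ t ∂(volume.restrict (Ioc 0 x₀)), k t = √(W (u t)) := by
    rw [intervalIntegral.integral_of_le hx₀] at hzero
    have := (integral_eq_zero_iff_of_nonneg (fun t => sq_nonneg _)
      ((intervalIntegrable_iff_integrableOn_Ioc_of_le hx₀).1 hsqi)).1 hzero
    filter_upwards [this] with t ht
    exact sub_eq_zero.1 (pow_eq_zero_iff two_ne_zero |>.1 ht)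
  -- Equality forces `k = √W(u) ≤ c u` on the ascent, and Grönwall from `u 0 = 0` makes the maximum
  -- vanish.
  have hgr : ∀ x ∈ Icc 0 x₀, u x ≤ c * ∫ t in (0 : ℝ)..x, u t := by
    intro x hx
    have h1 := (le_abs_self _).trans (h.bound 0 x hx.1)
    rw [hb, sub_zero] at h1
    refine h1.trans ?_
    rw [← intervalIntegral.integral_const_mul, intervalIntegral.integral_of_le hx.1,
      intervalIntegral.integral_of_le hx.1]
    refine integral_mono_ae
      ((intervalIntegrable_iff_integrableOn_Ioc_of_le hx.1).1 (h.k_intervalIntegrable 0 x))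
      ((continuous_const.mul h.cont).integrableOn_Ioc) ?_
    filter_upwards [ae_restrict_of_ae_restrict_of_subset (Ioc_subset_Ioc_right hx.2) hae]
      with t ht
    rw [ht]
    refine Real.sqrt_le_iff.2 ⟨mul_nonneg hc.le (h.u_nonneg t), ?_⟩
    rw [mul_pow]
    -- The bound on `W` is assumed only for positive arguments; at `0` it follows by continuity.
    rcases (h.u_nonneg t).eq_or_lt with h0 | h0
    · rw [← h0]
      have : ContinuousWithinAt W (Ioi 0) 0 := hWc.continuousWithinAt
      refine le_of_tendsto_of_tendsto this
        (g := fun t => c ^ 2 * t ^ 2) (Continuous.continuousWithinAt (by fun_prop)) ?_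
      filter_upwards [self_mem_nhdsWithin] with s hs using (hlt s hs).le
    · exact (hlt _ h0).le
  exact absurd (nonpos_of_le_mul_integral h.cont hc.le hx₀ hgr) (not_le.2 hpos)

end IncrementBound

/-! ### The soliton: first integral, decay and integral identities -/

/-- The real profile of the ground state `Q_{ω,0}`. -/
noncomputable def soliton (p ω x : ℝ) : ℝ :=
  (2 * (p + 1)) ^ (1 / (p - 1)) * ω ^ (1 / (p - 1)) *
    (2 * Real.cosh ((p - 1) / 2 * (√ω * x))) ^ (-(2 / (p - 1)))

/-- The potential in the first integral `q'² = ω q² - 2/(p+1) q^(p+1)` of the soliton equation. -/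
noncomputable def potential (p ω t : ℝ) : ℝ :=
  ω * t ^ 2 - 2 / (p + 1) * t ^ (p + 1)

theorem groundState_eq (p ω x : ℝ) : groundState p ω x = (soliton p ω x : ℂ) := rfl

theorem continuous_potential {p : ℝ} (hp : 1 < p) (ω : ℝ) : Continuous (potential p ω) := by
  have : Continuous fun t : ℝ => t ^ (p + 1) := Real.continuous_rpow_const (by linarith)
  unfold potential
  fun_prop

theorem rpow_add_one_eq {p t : ℝ} (hp : 1 < p) (ht : 0 ≤ t) :
    t ^ (p + 1) = t ^ (p - 1) * t ^ 2 := by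
  rw [← Real.rpow_natCast t 2, ← Real.rpow_add_of_nonneg ht (by linarith) (by norm_num)]
  congr 1
  push_cast
  ring

theorem soliton_pos {p ω : ℝ} (hp : 1 < p) (hω : 0 < ω) (x : ℝ) : 0 < soliton p ω x := by
  have := Real.cosh_pos ((p - 1) / 2 * (√ω * x))
  unfold soliton
  positivity

theorem soliton_abs (p ω x : ℝ) : soliton p ω |x| = soliton p ω x := by
  rcases abs_choice x with h | h <;> rw [h]
  unfold soliton
  rw [← Real.cosh_neg]
  congr 4
  ring

theorem soliton_rpow_sub_one {p ω : ℝ} (hp : 1 < p) (hω : 0 < ω) (x : ℝ) :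
    soliton p ω x ^ (p - 1) =
      (p + 1) * ω / 2 / Real.cosh ((p - 1) / 2 * (√ω * x)) ^ 2 := by
  have hc := Real.cosh_pos ((p - 1) / 2 * (√ω * x))
  have hp1 : p - 1 ≠ 0 := by linarith
  have e : -(2 / (p - 1)) * (p - 1) = -((2 : ℕ) : ℝ) := by field_simp; norm_num
  rw [soliton, Real.mul_rpow (by positivity) (by positivity),
    Real.mul_rpow (by positivity) (by positivity), ← Real.rpow_mul (by positivity),
    ← Real.rpow_mul (by positivity), ← Real.rpow_mul (by positivity), e,
    one_div_mul_cancel hp1, Real.rpow_one, Real.rpow_one, Real.rpow_neg (by positivity),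
    Real.rpow_natCast]
  field_simp

theorem soliton_zero_rpow_sub_one {p ω : ℝ} (hp : 1 < p) (hω : 0 < ω) :
    soliton p ω 0 ^ (p - 1) = (p + 1) * ω / 2 := by
  simp [soliton_rpow_sub_one hp hω]

/-- The derivative of the soliton profile. -/
noncomputable def solitonDeriv (p ω x : ℝ) : ℝ :=
  -(√ω * (Real.sinh ((p - 1) / 2 * (√ω * x)) / Real.cosh ((p - 1) / 2 * (√ω * x))) *
    soliton p ω x)

theorem hasDerivAt_phase (p ω x : ℝ) :
    HasDerivAt (fun x => (p - 1) / 2 * (√ω * x)) ((p - 1) / 2 * √ω) x := by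
  simpa using ((hasDerivAt_id x).const_mul √ω).const_mul ((p - 1) / 2)

theorem hasDerivAt_soliton {p : ℝ} (hp : 1 < p) (ω x : ℝ) :
    HasDerivAt (soliton p ω) (solitonDeriv p ω x) x := by
  have hc := Real.cosh_pos ((p - 1) / 2 * (√ω * x))
  have hp1 : p - 1 ≠ 0 := by linarith
  have h1 := ((hasDerivAt_phase p ω x).cosh.const_mul 2).rpow_const (p := -(2 / (p - 1)))
    (Or.inl (by positivity))
  refine (h1.const_mul ((2 * (p + 1)) ^ (1 / (p - 1)) * ω ^ (1 / (p - 1)))).congr_deriv ?_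
  rw [Real.rpow_sub_one (by positivity), solitonDeriv, soliton]
  field_simp

theorem continuous_soliton {p : ℝ} (hp : 1 < p) (ω : ℝ) : Continuous (soliton p ω) :=
  continuous_iff_continuousAt.2 fun x => (hasDerivAt_soliton hp ω x).continuousAt

theorem continuous_solitonDeriv {p : ℝ} (hp : 1 < p) (ω : ℝ) :
    Continuous (solitonDeriv p ω) := by
  have := continuous_soliton hp ω
  have h0 : ∀ x, Real.cosh ((p - 1) / 2 * (√ω * x)) ≠ 0 := fun x => (Real.cosh_pos _).ne'
  unfold solitonDeriv
  have h1 : Continuous fun x => Real.sinh ((p - 1) / 2 * (√ω * x)) :=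
    Real.continuous_sinh.comp (by fun_prop)
  have h2 : Continuous fun x => Real.cosh ((p - 1) / 2 * (√ω * x)) :=
    Real.continuous_cosh.comp (by fun_prop)
  exact ((continuous_const.mul (h1.div h2 h0)).mul this).neg

/-- The identity `cosh² = sinh² + 1`. It makes the soliton the equality case of the square
completion. -/
theorem solitonDeriv_sq {p ω : ℝ} (hp : 1 < p) (hω : 0 < ω) (x : ℝ) :
    solitonDeriv p ω x ^ 2 = potential p ω (soliton p ω x) := by
  have hc := Real.cosh_pos ((p - 1) / 2 * (√ω * x))
  have hs := Real.cosh_sq ((p - 1) / 2 * (√ω * x))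
  have hp1 : p + 1 ≠ 0 := by linarith
  rw [potential, rpow_add_one_eq hp (soliton_pos hp hω x).le, soliton_rpow_sub_one hp hω,
    solitonDeriv, neg_sq, mul_pow, mul_pow, div_pow, Real.sq_sqrt hω.le]
  generalize Real.sinh ((p - 1) / 2 * (√ω * x)) = S at *
  generalize Real.cosh ((p - 1) / 2 * (√ω * x)) = C at *
  field_simp
  rw [hs]
  ring

theorem soliton_le {p ω : ℝ} (hp : 1 < p) (hω : 0 < ω) (x : ℝ) :
    soliton p ω x ≤ (2 * (p + 1)) ^ (1 / (p - 1)) * ω ^ (1 / (p - 1)) *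
      Real.exp (-(√ω * |x|)) := by
  rw [← soliton_abs, soliton]
  refine mul_le_mul_of_nonneg_left ?_ (by positivity)
  have hp1 : 0 < p - 1 := by linarith
  have h1 : Real.exp ((p - 1) / 2 * (√ω * |x|)) ≤ 2 * Real.cosh ((p - 1) / 2 * (√ω * |x|)) := by
    rw [Real.cosh_eq]
    have := Real.exp_pos (-((p - 1) / 2 * (√ω * |x|)))
    linarith
  refine (Real.rpow_le_rpow_of_nonpos (Real.exp_pos _) h1
    (neg_nonpos.2 (by positivity))).trans_eq ?_
  rw [← Real.exp_mul]
  congr 1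
  field_simp

theorem tendsto_soliton_atTop {p ω : ℝ} (hp : 1 < p) (hω : 0 < ω) :
    Tendsto (soliton p ω) atTop (𝓝 0) := by
  refine squeeze_zero (fun x => (soliton_pos hp hω x).le) (soliton_le hp hω) ?_
  have h1 : Tendsto (fun x : ℝ => √ω * |x|) atTop atTop :=
    tendsto_abs_atTop_atTop.const_mul_atTop (Real.sqrt_pos.2 hω)
  simpa using (Real.tendsto_exp_neg_atTop_nhds_zero.comp h1).const_mul
    ((2 * (p + 1)) ^ (1 / (p - 1)) * ω ^ (1 / (p - 1)))

theorem tendsto_soliton_atBot {p ω : ℝ} (hp : 1 < p) (hω : 0 < ω) :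
    Tendsto (soliton p ω) atBot (𝓝 0) := by
  refine ((tendsto_soliton_atTop hp hω).comp tendsto_abs_atBot_atTop).congr fun x => ?_
  exact soliton_abs p ω x

theorem soliton_le_zero {p ω : ℝ} (hp : 1 < p) (x : ℝ) :
    soliton p ω x ≤ soliton p ω 0 := by
  have hp1 : 0 < p - 1 := by linarith
  by_cases hω : 0 ≤ ω
  · unfold soliton
    refine mul_le_mul_of_nonneg_left ?_ (by positivity)
    refine Real.rpow_le_rpow_of_nonpos (by simp) ?_ (neg_nonpos.2 (by positivity))
    simp [Real.one_le_cosh]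
  · simp [soliton, Real.sqrt_eq_zero_of_nonpos (not_le.1 hω).le]

theorem integrable_soliton_sq {p ω : ℝ} (hp : 1 < p) (hω : 0 < ω) :
    Integrable fun x => soliton p ω x ^ 2 := by
  have hcont := continuous_soliton hp ω
  have hI : IntegrableOn (fun x => soliton p ω x ^ 2) (Ioi 0) := by
    have h1 : IntegrableOn (fun x => ((2 * (p + 1)) ^ (1 / (p - 1)) * ω ^ (1 / (p - 1))) ^ 2 *
        Real.exp (-(2 * √ω) * x)) (Ioi 0) :=
      (integrableOn_exp_mul_Ioi (by have := Real.sqrt_pos.2 hω; linarith) 0).const_mul _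
    refine Integrable.mono' h1 (by fun_prop) ?_
    filter_upwards [ae_restrict_mem measurableSet_Ioi] with x hx
    rw [Real.norm_eq_abs, abs_of_nonneg (sq_nonneg _)]
    have h2 := soliton_le hp hω x
    rw [abs_of_pos hx] at h2
    refine (pow_le_pow_left₀ (soliton_pos hp hω x).le h2 2).trans_eq ?_
    rw [mul_pow, ← Real.exp_nat_mul]
    congr 2
    push_cast
    ring
  rw [← integrableOn_univ, ← Iic_union_Ioi (a := (0 : ℝ)), integrableOn_union]
  refine ⟨?_, hI⟩
  rw [← integrableOn_Ici_iff_integrableOn_Ioi, ← neg_zero (G := ℝ)] at hI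
  have := hI.comp_neg_Iic
  refine this.congr_fun (fun x _ => ?_) measurableSet_Iic
  simp only
  rw [← soliton_abs, abs_neg, soliton_abs]

theorem integrable_rpow_add_one {α : Type*} [MeasurableSpace α] {ν : Measure α} {p B : ℝ}
    (hp : 1 < p) {u : α → ℝ} (hu : AEStronglyMeasurable u ν) (h0 : ∀ x, 0 ≤ u x)
    (hB : ∀ᵐ x ∂ν, u x ≤ B) (hsq : Integrable (fun x => u x ^ 2) ν) :
    Integrable (fun x => u x ^ (p + 1)) ν := by
  refine Integrable.mono' (hsq.const_mul (B ^ (p - 1)))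
    ((Real.continuous_rpow_const (by linarith)).comp_aestronglyMeasurable hu) ?_
  filter_upwards [hB] with x hx
  rw [Real.norm_eq_abs, abs_of_nonneg (Real.rpow_nonneg (h0 x) _), rpow_add_one_eq hp (h0 x)]
  exact mul_le_mul_of_nonneg_right (Real.rpow_le_rpow (h0 x) hx (by linarith)) (sq_nonneg _)

theorem integrable_soliton_rpow {p ω : ℝ} (hp : 1 < p) (hω : 0 < ω) :
    Integrable fun x => soliton p ω x ^ (p + 1) :=
  integrable_rpow_add_one hp (continuous_soliton hp ω).aestronglyMeasurable
    (fun x => (soliton_pos hp hω x).le) (Eventually.of_forall (soliton_le_zero hp))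
    (integrable_soliton_sq hp hω)

theorem integrable_solitonDeriv_sq {p ω : ℝ} (hp : 1 < p) (hω : 0 < ω) :
    Integrable fun x => solitonDeriv p ω x ^ 2 := by
  simp_rw [solitonDeriv_sq hp hω]
  exact ((integrable_soliton_sq hp hω).const_mul _).sub
    ((integrable_soliton_rpow hp hω).const_mul _)

theorem integral_solitonDeriv_sq_eq_sub {p ω : ℝ} (hp : 1 < p) (hω : 0 < ω) :
    ∫ x, solitonDeriv p ω x ^ 2 =
      ω * (∫ x, soliton p ω x ^ 2) - 2 / (p + 1) * ∫ x, soliton p ω x ^ (p + 1) := by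
  simp_rw [solitonDeriv_sq hp hω, potential]
  rw [integral_sub ((integrable_soliton_sq hp hω).const_mul _)
    ((integrable_soliton_rpow hp hω).const_mul _), integral_const_mul, integral_const_mul]

/-- The Nehari identity for the soliton. -/
theorem soliton_nehari {p ω : ℝ} (hp : 1 < p) (hω : 0 < ω) :
    (∫ x, solitonDeriv p ω x ^ 2) + ω * (∫ x, soliton p ω x ^ 2) =
      ∫ x, soliton p ω x ^ (p + 1) := by
  -- This is `(q' q)' = q'² + q q''` with `q'' = ω q - q^p`; the boundary terms vanish at infinity.
  have hd : ∀ x, HasDerivAt (fun x => solitonDeriv p ω x * soliton p ω x)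
      (solitonDeriv p ω x ^ 2 + ω * soliton p ω x ^ 2 - soliton p ω x ^ (p + 1)) x := by
    intro x
    have hc := Real.cosh_pos ((p - 1) / 2 * (√ω * x))
    have hph := hasDerivAt_phase p ω x
    have h1 := ((((hph.sinh.div hph.cosh hc.ne').const_mul √ω).mul
      (hasDerivAt_soliton hp ω x)).neg).mul (hasDerivAt_soliton hp ω x)
    refine h1.congr_deriv ?_
    have hs := Real.cosh_sq ((p - 1) / 2 * (√ω * x))
    have hω2 : √ω ^ 2 = ω := Real.sq_sqrt hω.le
    rw [rpow_add_one_eq hp (soliton_pos hp hω x).le, soliton_rpow_sub_one hp hω]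
    simp only [solitonDeriv, Pi.div_apply, Pi.mul_apply, Pi.neg_apply]
    clear h1 hph
    have hsq : Real.sinh ((p - 1) / 2 * (√ω * x)) ^ 2 =
      Real.cosh ((p - 1) / 2 * (√ω * x)) ^ 2 - 1 := by rw [hs]; ring
    generalize Real.sinh ((p - 1) / 2 * (√ω * x)) = S at *
    generalize Real.cosh ((p - 1) / 2 * (√ω * x)) = C at *
    generalize soliton p ω x = q at *
    generalize √ω = r at *
    subst hω2
    field_simp
    linear_combination r ^ 2 * q ^ 2 * (p + 1) * hsq
  have hbd : ∀ x, |solitonDeriv p ω x * soliton p ω x| ≤ √ω * soliton p ω x ^ 2 := by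
    intro x
    have h1 : |solitonDeriv p ω x| ≤ √ω * soliton p ω x := by
      refine abs_le_of_sq_le_sq ?_ (mul_nonneg (Real.sqrt_nonneg _) (soliton_pos hp hω x).le)
      rw [solitonDeriv_sq hp hω, potential, mul_pow, Real.sq_sqrt hω.le]
      have := (soliton_pos hp hω x).le
      have : 0 ≤ 2 / (p + 1) * soliton p ω x ^ (p + 1) := by
        have : 0 < p + 1 := by linarith
        positivity
      linarith
    rw [abs_mul, abs_of_pos (soliton_pos hp hω x), sq, ← mul_assoc]
    exact mul_le_mul_of_nonneg_right h1 (soliton_pos hp hω x).le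
  have hlim : ∀ l : Filter ℝ, Tendsto (soliton p ω) l (𝓝 0) →
      Tendsto (fun x => solitonDeriv p ω x * soliton p ω x) l (𝓝 0) := by
    intro l hl
    refine squeeze_zero_norm hbd ?_
    simpa using (hl.pow 2).const_mul √ω
  have hi1 : Integrable fun x => solitonDeriv p ω x ^ 2 + ω * soliton p ω x ^ 2 :=
    (integrable_solitonDeriv_sq hp hω).add ((integrable_soliton_sq hp hω).const_mul ω)
  have := integral_of_hasDerivAt_of_tendsto hd (hi1.sub (integrable_soliton_rpow hp hω))
    (hlim _ (tendsto_soliton_atBot hp hω)) (hlim _ (tendsto_soliton_atTop hp hω))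
  rw [integral_sub hi1 (integrable_soliton_rpow hp hω),
    integral_add (integrable_solitonDeriv_sq hp hω) ((integrable_soliton_sq hp hω).const_mul ω),
    integral_const_mul, sub_zero] at this
  linarith

/-- On the right half-line `q' = -√W(q)`, so `-q'²` is the derivative of a primitive of `√W`
composed with `q`. Evenness doubles the result. -/
theorem integral_solitonDeriv_sq_eq_two_mul {p ω : ℝ} (hp : 1 < p) (hω : 0 < ω) :
    ∫ x, solitonDeriv p ω x ^ 2 =
      2 * ∫ t in (0 : ℝ)..(soliton p ω 0), √(potential p ω t) := by
  set F : ℝ → ℝ := fun s => ∫ t in (0 : ℝ)..s, √(potential p ω t) with hF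
  have hFd : ∀ s, HasDerivAt F (√(potential p ω s)) s :=
    hasDerivAt_integral_sqrt (continuous_potential hp ω)
  have hFc : Continuous F := continuous_iff_continuousAt.2 fun s => (hFd s).continuousAt
  have hd : ∀ x ∈ Ioi (0 : ℝ), HasDerivAt (fun x => F (soliton p ω x))
      (-solitonDeriv p ω x ^ 2) x := by
    intro x hx
    refine ((hFd _).comp x (hasDerivAt_soliton hp ω x)).congr_deriv ?_
    have hneg : solitonDeriv p ω x ≤ 0 := by
      have h1 := soliton_pos hp hω x
      have h2 := Real.cosh_pos ((p - 1) / 2 * (√ω * x))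
      have h3 : 0 ≤ Real.sinh ((p - 1) / 2 * (√ω * x)) := by
        rw [Real.sinh_nonneg_iff]
        have : 0 < x := hx
        have : 0 < p - 1 := by linarith
        positivity
      rw [solitonDeriv, neg_nonpos]
      positivity
    rw [← solitonDeriv_sq hp hω, Real.sqrt_sq_eq_abs, abs_of_nonpos hneg]
    ring
  have hint := (integrable_solitonDeriv_sq hp hω)
  have h1 := integral_Ioi_of_hasDerivAt_of_tendsto
    (hFc.comp (continuous_soliton hp ω)).continuousWithinAt hd hint.neg.integrableOn
    ((hFc.tendsto 0).comp (tendsto_soliton_atTop hp hω))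
  have h0 : F 0 = 0 := by simp [hF]
  rw [integral_neg, h0, zero_sub, neg_inj] at h1
  have h2 : ∫ x, solitonDeriv p ω x ^ 2 = 2 * ∫ x in Ioi (0 : ℝ), solitonDeriv p ω x ^ 2 := by
    simp_rw [solitonDeriv_sq hp hω]
    rw [← integral_comp_abs (f := fun x => potential p ω (soliton p ω x))]
    simp_rw [soliton_abs]
  rw [h2, h1]
  rfl

/-- The integrated first integral and the Nehari identity are two linear relations between three
integrals, so the mass determines the other two. -/
theorem integral_solitonDeriv_sq {p ω : ℝ} (hp : 1 < p) (hω : 0 < ω) :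
    ∫ x, solitonDeriv p ω x ^ 2 = (p - 1) / (p + 3) * (ω * ∫ x, soliton p ω x ^ 2) := by
  have h1 := soliton_nehari hp hω
  have h2 := integral_solitonDeriv_sq_eq_sub hp hω
  have hp1 : p + 1 ≠ 0 := by linarith
  have hp3 : p + 3 ≠ 0 := by linarith
  rw [← h1] at h2
  field_simp at h2 ⊢
  linear_combination h2

theorem integral_soliton_rpow {p ω : ℝ} (hp : 1 < p) (hω : 0 < ω) :
    ∫ x, soliton p ω x ^ (p + 1) = 2 * (p + 1) / (p + 3) * (ω * ∫ x, soliton p ω x ^ 2) := by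
  rw [← soliton_nehari hp hω, integral_solitonDeriv_sq hp hω]
  have hp3 : p + 3 ≠ 0 := by linarith
  field_simp
  ring

theorem integral_soliton_sq_pos {p ω : ℝ} (hp : 1 < p) (hω : 0 < ω) :
    0 < ∫ x, soliton p ω x ^ 2 :=
  integral_pos_of_integrable_nonneg_nonzero (x := 0) ((continuous_soliton hp ω).pow 2)
    (integrable_soliton_sq hp hω) (fun _ => sq_nonneg _) (pow_pos (soliton_pos hp hω 0) 2).ne'

theorem integral_soliton_sq_eq (p : ℝ) {ω : ℝ} (hω : 0 < ω) :
    ∫ x, soliton p ω x ^ 2 = ω ^ (-sc p) * ∫ x, soliton p 1 x ^ 2 := by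
  have h1 : ∀ x, soliton p ω x ^ 2 = ω ^ (2 / (p - 1)) * soliton p 1 (√ω * x) ^ 2 := by
    intro x
    have : ω ^ (2 / (p - 1)) = (ω ^ (1 / (p - 1))) ^ 2 := by
      rw [← Real.rpow_natCast, ← Real.rpow_mul hω.le]
      congr 1
      push_cast
      ring
    rw [this]
    simp only [soliton, Real.sqrt_one, one_mul, Real.one_rpow]
    ring
  simp_rw [h1]
  rw [integral_const_mul, Measure.integral_comp_mul_left (fun x => soliton p 1 x ^ 2) (√ω),
    abs_of_pos (inv_pos.2 (Real.sqrt_pos.2 hω)), smul_eq_mul, ← mul_assoc, Real.sqrt_eq_rpow,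
    ← Real.rpow_neg hω.le, ← Real.rpow_add hω, sc]
  congr 2
  ring

theorem integral_soliton_rpow_pos {p ω : ℝ} (hp : 1 < p) (hω : 0 < ω) :
    0 < ∫ x, soliton p ω x ^ (p + 1) := by
  rw [integral_soliton_rpow hp hω]
  have := integral_soliton_sq_pos hp hω
  have : 0 < p + 3 := by linarith
  positivity

/-- The Pohozaev identity: the free virial functional vanishes at the soliton. -/
theorem integral_solitonDeriv_sq_eq_mul_rpow {p ω : ℝ} (hp : 1 < p) (hω : 0 < ω) :
    ∫ x, solitonDeriv p ω x ^ 2 =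
      (p - 1) / (2 * (p + 1)) * ∫ x, soliton p ω x ^ (p + 1) := by
  rw [integral_soliton_rpow hp hω, integral_solitonDeriv_sq hp hω]
  have : 0 < p + 3 := by linarith
  field_simp

/-! ### The sharp inequality for even functions on the line -/

/-- For `B = 2A` the left side is maximal at `c = 1`, where both sides agree. Bernoulli applied to
`c²` with exponent `(p+1)/2` proves this. -/
theorem sq_mul_sub_le {p c A B : ℝ} (hp : 1 < p) (hc : 0 < c) (hA : 0 ≤ A) (hB : 2 * A ≤ B) :
    c ^ 2 * (2 * A) - 2 / (p + 1) * (c ^ (p + 1) * B) ≤ 4 * ((p - 1) / (2 * (p + 1)) * A) := by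
  have hbern : 1 + (p + 1) / 2 * (c ^ 2 - 1) ≤ c ^ (p + 1) := by
    have := one_add_mul_self_le_rpow_one_add (s := c ^ 2 - 1) (by nlinarith [sq_nonneg c])
      (p := (p + 1) / 2) (by linarith)
    rw [add_sub_cancel, ← Real.rpow_natCast, ← Real.rpow_mul hc.le,
      show ((2 : ℕ) : ℝ) * ((p + 1) / 2) = p + 1 by push_cast; ring] at this
    simpa using this
  have h2 : (1 + (p + 1) / 2 * (c ^ 2 - 1)) * (2 * A) ≤ c ^ (p + 1) * B :=
    (mul_le_mul_of_nonneg_right hbern (by positivity)).trans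
      (mul_le_mul_of_nonneg_left hB (by positivity))
  have hp1 : 0 < p + 1 := by linarith
  have h3 := mul_le_mul_of_nonneg_left h2 (show 0 ≤ 2 / (p + 1) by positivity)
  have h4 : 2 / (p + 1) * ((1 + (p + 1) / 2 * (c ^ 2 - 1)) * (2 * A)) =
      c ^ 2 * (2 * A) - 4 * ((p - 1) / (2 * (p + 1)) * A) := by
    field_simp
    ring
  linarith

namespace IncrementBound

variable {u k : ℝ → ℝ}

/-- The half-line bound is used for `u` and for its reflection. The soliton peak is the positive
zero of the potential, so the potential is nonnegative on the range of `u` and its square root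
integrates to half of `∫ q'²`. -/
theorem lt_of_max_eq_soliton (h : IncrementBound u k) (heven : ∀ x, u (-x) = u x)
    {p ω μ x₀ : ℝ} (hp : 1 < p) (hω : 0 < ω) (hμ : √ω ≤ μ) (hx₀ : 0 ≤ x₀)
    (hmax : ∀ x, 0 ≤ x → u x ≤ u x₀) (hA : u x₀ = soliton p ω 0) :
    4 * ∫ x, solitonDeriv p ω x ^ 2 <
      (∫ x, k x ^ 2) + 2 * μ * u 0 ^ 2 + ω * (∫ x, u x ^ 2) -
        2 / (p + 1) * ∫ x, u x ^ (p + 1) := by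
  have hp1 : 0 < p + 1 := by linarith
  have hpos : 0 < u x₀ := hA ▸ soliton_pos hp hω 0
  have hle : ∀ x, u x ≤ u x₀ := fun x => by
    rcases le_total 0 x with hx | hx
    · exact hmax x hx
    · rw [← heven]
      exact hmax _ (neg_nonneg.2 hx)
  have hN : Integrable fun x => u x ^ (p + 1) :=
    integrable_rpow_add_one hp h.cont.aestronglyMeasurable h.u_nonneg
      (Eventually.of_forall hle) h.u_sq
  have hWi : Integrable fun x => potential p ω (u x) :=
    (h.u_sq.const_mul ω).sub (hN.const_mul (2 / (p + 1)))
  have hW0 : ∀ t, 0 ≤ t → t ≤ u x₀ → 0 ≤ potential p ω t := by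
    intro t ht ht'
    have h1 := Real.rpow_le_rpow ht ht' (show 0 ≤ p - 1 by linarith)
    rw [hA, soliton_zero_rpow_sub_one hp hω] at h1
    have h2 : 2 / (p + 1) * t ^ (p - 1) ≤ ω := by
      rw [div_mul_eq_mul_div, div_le_iff₀ hp1]
      linarith
    rw [potential, rpow_add_one_eq hp ht]
    nlinarith [sq_nonneg t]
  have hlt : ∀ t, 0 < t → potential p ω t < √ω ^ 2 * t ^ 2 := by
    intro t ht
    rw [Real.sq_sqrt hω.le, potential]
    have : 0 < 2 / (p + 1) * t ^ (p + 1) := by positivity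
    linarith
  have hWc := continuous_potential hp ω
  have hr := h.four_mul_integral_sqrt_lt hWc (Real.sqrt_pos.2 hω) hμ hx₀ hpos hmax hW0 hlt
    hWi.integrableOn
  have hl := h.comp_neg.four_mul_integral_sqrt_lt hWc (Real.sqrt_pos.2 hω) hμ hx₀
    (by rw [heven]; exact hpos) (fun x hx => by rw [heven, heven]; exact hmax x hx)
    (fun t ht ht' => hW0 t ht (by rwa [heven] at ht')) hlt hWi.comp_neg.integrableOn
  simp only [neg_zero] at hl
  rw [heven, integral_comp_neg_Ioi 0 (fun t => k t ^ 2 + potential p ω (u t)), neg_zero] at hl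
  have hI : Integrable fun t => k t ^ 2 + potential p ω (u t) := h.k_sq.add hWi
  have hsum := intervalIntegral.integral_Iic_add_Ioi (b := (0 : ℝ)) hI.integrableOn hI.integrableOn
  have htot : ∫ t, (k t ^ 2 + potential p ω (u t)) =
      (∫ x, k x ^ 2) + (ω * (∫ x, u x ^ 2) - 2 / (p + 1) * ∫ x, u x ^ (p + 1)) := by
    rw [integral_add h.k_sq hWi]
    simp only [potential]
    rw [integral_sub (h.u_sq.const_mul ω) (hN.const_mul (2 / (p + 1))), integral_const_mul,
      integral_const_mul]
  rw [htot] at hsum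
  rw [integral_solitonDeriv_sq_eq_two_mul hp hω, ← hA]
  linarith

/-- A sharp Gagliardo-Nirenberg type inequality for even functions, with a Robin term at the
origin. -/
theorem rpow_mul_integral_lt (h : IncrementBound u k) (heven : ∀ x, u (-x) = u x)
    (hne : ∃ x, 0 < u x) {p ω μ l : ℝ} (hp : 1 < p) (hω : 0 < ω) (hμ : √ω ≤ μ) (hl : 0 < l)
    (hX : l ^ 2 * (∫ x, k x ^ 2) + 2 * l * μ * u 0 ^ 2 + ω * (∫ x, u x ^ 2) =
      2 * ∫ x, soliton p ω x ^ (p + 1)) :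
    l ^ ((p - 1) / 2) * (∫ x, u x ^ (p + 1)) < 2 * ∫ x, soliton p ω x ^ (p + 1) := by
  have hp1 : 0 < p + 1 := by linarith
  obtain ⟨x₀, hx₀, hpos, hmax⟩ := h.exists_max (by
    obtain ⟨x, hx⟩ := hne
    rcases le_total 0 x with h0 | h0
    · exact ⟨x, h0, hx⟩
    · exact ⟨-x, neg_nonneg.2 h0, by rwa [heven]⟩)
  have hsl : 0 < √l := Real.sqrt_pos.2 hl
  have hA := soliton_pos hp hω 0
  -- The amplitude `c` lifts the maximum of `√l u(l ·)` to the soliton peak, now attained at `x₀ /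
  -- l`.
  obtain ⟨c, hc0, hcA⟩ : ∃ c : ℝ, 0 < c ∧ c * √l * u x₀ = soliton p ω 0 :=
    ⟨soliton p ω 0 / (√l * u x₀), by positivity, by field_simp⟩
  have hmain := (h.scale (α := c * √l) (l := l) (by positivity) hl).lt_of_max_eq_soliton
    (fun x => by rw [mul_neg, heven]) hp hω hμ (x₀ := x₀ / l) (by positivity)
    (fun x hx => by
      rw [mul_div_cancel₀ _ hl.ne']
      exact mul_le_mul_of_nonneg_left (hmax _ (by positivity)) (by positivity))
    (by rw [mul_div_cancel₀ _ hl.ne', hcA])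
  have hsq : √l ^ 2 = l := Real.sq_sqrt hl.le
  have e1 : ∫ x, (c * √l * l * k (l * x)) ^ 2 = c ^ 2 * (l ^ 2 * ∫ x, k x ^ 2) := by
    simp_rw [mul_pow]
    rw [integral_const_mul, Measure.integral_comp_mul_left (fun x => k x ^ 2), smul_eq_mul,
      abs_of_pos (inv_pos.2 hl), hsq]
    field_simp
  have e2 : ∫ x, (c * √l * u (l * x)) ^ 2 = c ^ 2 * ∫ x, u x ^ 2 := by
    simp_rw [mul_pow]
    rw [integral_const_mul, Measure.integral_comp_mul_left (fun x => u x ^ 2), smul_eq_mul,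
      abs_of_pos (inv_pos.2 hl), hsq]
    field_simp
  have e3 : ∫ x, (c * √l * u (l * x)) ^ (p + 1) =
      c ^ (p + 1) * (l ^ ((p - 1) / 2) * ∫ x, u x ^ (p + 1)) := by
    have : ∀ x, (c * √l * u (l * x)) ^ (p + 1) =
        c ^ (p + 1) * l ^ ((p + 1) / 2) * u (l * x) ^ (p + 1) := fun x => by
      rw [Real.mul_rpow (by positivity) (h.u_nonneg _), Real.mul_rpow hc0.le hsl.le,
        Real.sqrt_eq_rpow, ← Real.rpow_mul hl.le]
      congr 3
      ring
    simp_rw [this]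
    rw [integral_const_mul, Measure.integral_comp_mul_left (fun x => u x ^ (p + 1)), smul_eq_mul,
      abs_of_pos (inv_pos.2 hl), show (p + 1) / 2 = (p - 1) / 2 + 1 by ring,
      Real.rpow_add_one hl.ne']
    field_simp
  rw [e1, e2, e3, mul_zero, mul_pow, mul_pow, hsq] at hmain
  rw [integral_solitonDeriv_sq_eq_mul_rpow hp hω] at hmain
  by_contra hcon
  push Not at hcon
  -- If the claim failed, no amplitude `c` could exceed the value of two solitons, against `hmain`.
  have h1 := sq_mul_sub_le hp hc0 (integral_soliton_rpow_pos hp hω).le hcon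
  rw [← hX] at h1
  linarith

theorem energy_pos (h : IncrementBound u k) (heven : ∀ x, u (-x) = u x)
    (hne : ∃ x, 0 < u x) {c : ℝ} (hc : 0 < c) : 0 < (∫ x, k x ^ 2) + c * u 0 ^ 2 := by
  have hk : 0 ≤ ∫ x, k x ^ 2 := integral_nonneg fun x => sq_nonneg _
  by_contra hcon
  push Not at hcon
  have h0 : 0 ≤ c * u 0 ^ 2 := by positivity
  have hu0 : u 0 = 0 := by
    have : c * u 0 ^ 2 = 0 := by linarith
    simpa [hc.ne'] using this
  have hk0 : k =ᵐ[volume] 0 := by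
    have : ∫ x, k x ^ 2 = 0 := by linarith
    have := (integral_eq_zero_iff_of_nonneg (fun x => sq_nonneg _) h.k_sq).1 this
    filter_upwards [this] with x hx
    simpa using hx
  have hz : ∀ x, 0 ≤ x → u x = 0 := by
    intro x hx
    have h1 := h.bound 0 x hx
    rw [intervalIntegral.integral_congr_ae (g := fun _ => (0 : ℝ))
      (by filter_upwards [hk0] with t ht _ using ht), hu0] at h1
    simpa using h1
  obtain ⟨x, hx⟩ := hne
  rcases le_total 0 x with h1 | h1
  · exact hx.ne' (hz x h1)
  · exact hx.ne' (by rw [← heven]; exact hz _ (neg_nonneg.2 h1))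

end IncrementBound

/-! ### From the sharp inequality to the sign of the virial functional -/

/-- The sign of the virial quantity is decided by the kinetic energy below the threshold. -/
theorem virial_trichotomy {p D a N μ D₀ : ℝ} (hp : 5 < p) (hD : 0 ≤ D) (ha : 0 ≤ a) (hN : 0 ≤ N)
    (hμ : 0 < μ) (hH : 0 < D + 2 * μ * a)
    (hE : D / 2 + μ * a - N / (p + 1) ≤ sc p * D₀)
    (hS : ∀ l : ℝ, 0 < l → l ^ 2 * D + 2 * l * μ * a = D₀ →
      l ^ ((p - 1) / 2) * N < 2 * (p + 1) / (p - 1) * D₀) (hD₀ : 0 < D₀) :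
    D + 2 * μ * a ≠ D₀ ∧
    (D + 2 * μ * a < D₀ → 0 < D + μ * a - (p - 1) / (2 * (p + 1)) * N) ∧
    (D₀ < D + 2 * μ * a → D + μ * a - (p - 1) / (2 * (p + 1)) * N < 0) := by
  have hp1 : 0 < p + 1 := by linarith
  have hpm : 0 < p - 1 := by linarith
  have hma : 0 ≤ μ * a := by positivity
  -- For `D = ‖f'‖²` and `a = |f(0)|²`, this is the squared `Ḣ¹_γ` norm of `√l f(l ·)`.
  set g : ℝ → ℝ := fun l => l ^ 2 * D + 2 * l * μ * a with hg
  have hgc : Continuous g := by fun_prop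
  have hψ : ∀ l : ℝ, 0 < l → g l = D₀ →
      D / 2 + μ * a - N / (p + 1) <
        l ^ 2 * D / 2 + l * (μ * a) - l ^ ((p - 1) / 2) * N / (p + 1) := by
    intro l hl hgl
    refine hE.trans_lt ?_
    have h1 : l ^ ((p - 1) / 2) * N / (p + 1) < 2 / (p - 1) * D₀ := by
      rw [div_lt_iff₀ hp1]
      refine (hS l hl hgl).trans_eq ?_
      field_simp
    have h2 : l ^ 2 * D + 2 * l * μ * a = D₀ := hgl
    have h3 : sc p * D₀ = D₀ / 2 - 2 / (p - 1) * D₀ := by rw [sc]; ring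
    linarith
  have hbern : ∀ l : ℝ, 0 < l → N / (p + 1) * (1 + (p - 1) / 4 * (l ^ 2 - 1)) ≤
      l ^ ((p - 1) / 2) * N / (p + 1) := by
    intro l hl
    have := one_add_mul_self_le_rpow_one_add (s := l ^ 2 - 1) (by nlinarith [sq_nonneg l])
      (p := (p - 1) / 4) (by linarith)
    rw [add_sub_cancel, ← Real.rpow_natCast, ← Real.rpow_mul hl.le,
      show ((2 : ℕ) : ℝ) * ((p - 1) / 4) = (p - 1) / 2 by push_cast; ring] at this
    rw [mul_div_assoc, mul_comm]
    refine mul_le_mul_of_nonneg_right ?_ (by positivity)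
    simpa using this
  have hcomb : ∀ l : ℝ, 0 < l → g l = D₀ →
      0 < (l ^ 2 - 1) * (D + μ * a - (p - 1) / (2 * (p + 1)) * N) := by
    intro l hl hgl
    have h1 := hψ l hl hgl
    have h2 := hbern l hl
    have h3 : N / (p + 1) * (1 + (p - 1) / 4 * (l ^ 2 - 1)) =
      N / (p + 1) + (l ^ 2 - 1) / 2 * ((p - 1) / (2 * (p + 1)) * N) := by field_simp; ring
    -- The point term scales like `l`, and `l - 1 = (l² - 1)/2 - (l - 1)²/2`; the last square has
    -- the favourable sign.
    nlinarith [mul_nonneg hma (sq_nonneg (l - 1))]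
  refine ⟨fun heq => ?_, fun hlt => ?_, fun hgt => ?_⟩
  · have := hψ 1 one_pos (by simp only [hg]; linarith)
    simp at this
  · set L := D₀ / (D + 2 * μ * a) with hL
    have hL1 : 1 ≤ L := (one_le_div hH).2 hlt.le
    have hLe : L * (D + 2 * μ * a) = D₀ := div_mul_cancel₀ _ hH.ne'
    -- For `L ≥ 1`, `g L ≥ L (D + 2μa) = D₀`, so the level `D₀` is reached in `[1, L]`.
    obtain ⟨l, hl, hgl⟩ := intermediate_value_Icc hL1 hgc.continuousOn
      (show D₀ ∈ Icc (g 1) (g L) from ⟨by simp only [hg]; linarith, by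
        simp only [hg]
        nlinarith [mul_nonneg (mul_nonneg (sub_nonneg.2 hL1) (by linarith : 0 ≤ L)) hD]⟩)
    have h1 := hcomb l (by linarith [hl.1]) hgl
    exact pos_of_mul_pos_right h1 (by nlinarith [hl.1])
  · obtain ⟨l, hl, hgl⟩ := intermediate_value_Icc zero_le_one hgc.continuousOn
      (show D₀ ∈ Icc (g 0) (g 1) from ⟨by simp [hg, hD₀.le], by simp only [hg]; linarith⟩)
    have hl0 : 0 < l := lt_of_le_of_ne hl.1 fun h0 => by
      rw [← h0] at hgl
      simp [hg] at hgl
      exact hD₀.ne hgl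
    have h1 := hcomb l hl0 hgl
    by_contra hcon
    push Not at hcon
    nlinarith [mul_nonneg (show 0 ≤ 1 - l ^ 2 by nlinarith [hl.2]) hcon]


/-! ### Norms of `f` and of the ground state as integrals -/

theorem normL_rpow_self {q : ℝ} (hq : 0 < q) {f : ℝ → ℂ} (hf : AEStronglyMeasurable f)
    (hi : Integrable fun x => ‖f x‖ ^ q) : normL q f ^ q = ∫ x, ‖f x‖ ^ q := by
  have h0 : ENNReal.ofReal q ≠ 0 := by simpa using hq
  have hr : (ENNReal.ofReal q).toReal = q := ENNReal.toReal_ofReal hq.le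
  have hm : MemLp f (ENNReal.ofReal q) volume := by
    rw [← integrable_norm_rpow_iff hf h0 ENNReal.ofReal_ne_top, hr]
    exact hi
  have hnn : 0 ≤ ∫ x, ‖f x‖ ^ q := integral_nonneg fun x => by positivity
  rw [normL, hm.eLpNorm_eq_integral_rpow_norm h0 ENNReal.ofReal_ne_top, hr,
    ENNReal.toReal_ofReal (by positivity), ← Real.rpow_mul hnn, inv_mul_cancel₀ hq.ne',
    Real.rpow_one]

theorem normL_two_sq {f : ℝ → ℂ} (hf : MemLp f 2 volume) :
    normL 2 f ^ 2 = ∫ x, ‖f x‖ ^ 2 := by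
  have hi := (memLp_two_iff_integrable_sq_norm hf.1).1 hf
  have := normL_rpow_self (q := 2) two_pos hf.1 (by simpa using hi)
  simpa using this

theorem normL_nonneg (q : ℝ) (f : ℝ → ℂ) : 0 ≤ normL q f := ENNReal.toReal_nonneg

theorem normL_two_eq (f : ℝ → ℂ) : normL 2 f = √(mass f) :=
  (Real.sqrt_sq (normL_nonneg 2 f)).symm

theorem HasWeakDeriv.hasWeakDeriv_weakDeriv {f g : ℝ → ℂ} (h : HasWeakDeriv f g) :
    HasWeakDeriv f (weakDeriv f) := by
  have h' : ∃ g, HasWeakDeriv f g := ⟨g, h⟩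
  have e : weakDeriv f = h'.choose := by simp only [weakDeriv, dif_pos h']
  rw [e]
  exact h'.choose_spec

theorem MemH1.hasWeakDeriv {f : ℝ → ℂ} (hf : MemH1 f) : HasWeakDeriv f (weakDeriv f) := by
  obtain ⟨-, -, g, hg, -⟩ := hf
  exact hg.hasWeakDeriv_weakDeriv

theorem MemH1.memLp_weakDeriv {f : ℝ → ℂ} (hf : MemH1 f) : MemLp (weakDeriv f) 2 volume := by
  obtain ⟨-, -, g, hg, hg2⟩ := hf
  exact hg2.ae_eq hg.weakDeriv_ae_eq.symm

theorem MemH1.incrementBound {f : ℝ → ℂ} (hf : MemH1 f) :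
    IncrementBound (fun x => ‖f x‖) fun x => ‖weakDeriv f x‖ where
  cont := hf.1.norm
  u_nonneg _ := norm_nonneg _
  k_nonneg _ := norm_nonneg _
  u_sq := (memLp_two_iff_integrable_sq_norm hf.2.1.1).1 hf.2.1
  k_sq := (memLp_two_iff_integrable_sq_norm hf.memLp_weakDeriv.1).1 hf.memLp_weakDeriv
  k_loc x := (hf.hasWeakDeriv.2.1 x).norm
  bound _ _ hxy := hf.hasWeakDeriv.abs_norm_sub_norm_le hf.1 hxy

theorem MemH1.integrable_norm_rpow {f : ℝ → ℂ} (hf : MemH1 f) (heven : ∀ x, f (-x) = f x)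
    {p : ℝ} (hp : 1 < p) : Integrable fun x => ‖f x‖ ^ (p + 1) := by
  by_cases hne : ∃ x, 0 ≤ x ∧ 0 < ‖f x‖
  · obtain ⟨x₀, -, -, hmax⟩ := hf.incrementBound.exists_max hne
    refine integrable_rpow_add_one hp hf.1.norm.aestronglyMeasurable (fun x => norm_nonneg _)
      (Eventually.of_forall fun x => ?_) hf.incrementBound.u_sq (B := ‖f x₀‖)
    rcases le_total 0 x with h | h
    · exact hmax x h
    · rw [← heven]
      exact hmax _ (neg_nonneg.2 h)
  · push Not at hne
    have hz : ∀ x, f x = 0 := fun x => by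
      rcases le_total 0 x with h | h
      · exact norm_le_zero_iff.1 (hne x h)
      · rw [← heven]
        exact norm_le_zero_iff.1 (hne _ (neg_nonneg.2 h))
    simp [hz, Real.zero_rpow (show p + 1 ≠ 0 by linarith)]

theorem norm_groundState {p ω : ℝ} (hp : 1 < p) (hω : 0 < ω) (x : ℝ) :
    ‖groundState p ω x‖ = soliton p ω x := by
  rw [groundState_eq, Complex.norm_real, Real.norm_eq_abs, abs_of_pos (soliton_pos hp hω x)]

theorem continuous_groundState {p : ℝ} (hp : 1 < p) (ω : ℝ) : Continuous (groundState p ω) :=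
  Complex.continuous_ofReal.comp (continuous_soliton hp ω)

theorem hasWeakDeriv_groundState {p : ℝ} (hp : 1 < p) (ω : ℝ) :
    HasWeakDeriv (groundState p ω) fun x => (solitonDeriv p ω x : ℂ) := by
  have hq := continuous_soliton hp ω
  have hq' := continuous_solitonDeriv hp ω
  refine ⟨(continuous_groundState hp ω).locallyIntegrable,
    (Complex.continuous_ofReal.comp hq').locallyIntegrable, fun φ hφ hc => ?_⟩
  have hφ' : Continuous (deriv φ) := hφ.continuous_deriv (by simp)
  have h1 := integral_mul_deriv_eq_deriv_mul_of_integrable (u := soliton p ω) (v := φ)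
    (u' := solitonDeriv p ω) (v' := deriv φ) (fun x _ => hasDerivAt_soliton hp ω x)
    (fun x _ => (hφ.differentiable (by simp) x).hasDerivAt)
    ((hq.mul hφ').integrable_of_hasCompactSupport hc.deriv.mul_left)
    ((hq'.mul hφ.continuous).integrable_of_hasCompactSupport hc.mul_left)
    ((hq.mul hφ.continuous).integrable_of_hasCompactSupport hc.mul_left)
  have e1 : ∀ x, deriv φ x • groundState p ω x = ((soliton p ω x * deriv φ x : ℝ) : ℂ) := fun x => by
    rw [groundState_eq, Complex.real_smul, Complex.ofReal_mul, mul_comm]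
  have e2 : ∀ x, φ x • (solitonDeriv p ω x : ℂ) = ((solitonDeriv p ω x * φ x : ℝ) : ℂ) := fun x => by
    rw [Complex.real_smul, Complex.ofReal_mul, mul_comm]
  simp_rw [e1, e2]
  rw [integral_complex_ofReal, integral_complex_ofReal, h1, Complex.ofReal_neg]

theorem mass_groundState {p ω : ℝ} (hp : 1 < p) (hω : 0 < ω) :
    mass (groundState p ω) = ∫ x, soliton p ω x ^ 2 := by
  have hc := (continuous_groundState hp ω).aestronglyMeasurable (μ := volume)
  rw [mass, normL_two_sq]
  · simp_rw [norm_groundState hp hω]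
  · rw [memLp_two_iff_integrable_sq_norm hc]
    simp_rw [norm_groundState hp hω]
    exact integrable_soliton_sq hp hω

theorem normL_groundState_rpow {p ω : ℝ} (hp : 1 < p) (hω : 0 < ω) :
    normL (p + 1) (groundState p ω) ^ (p + 1) = ∫ x, soliton p ω x ^ (p + 1) := by
  rw [normL_rpow_self (by linarith) (continuous_groundState hp ω).aestronglyMeasurable]
  · simp_rw [norm_groundState hp hω]
  · simp_rw [norm_groundState hp hω]
    exact integrable_soliton_rpow hp hω

theorem normL_weakDeriv_groundState_sq {p ω : ℝ} (hp : 1 < p) (hω : 0 < ω) :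
    normL 2 (weakDeriv (groundState p ω)) ^ 2 = ∫ x, solitonDeriv p ω x ^ 2 := by
  have hc : AEStronglyMeasurable (fun x => (solitonDeriv p ω x : ℂ)) volume :=
    (Complex.continuous_ofReal.comp (continuous_solitonDeriv hp ω)).aestronglyMeasurable
  have e : normL 2 (weakDeriv (groundState p ω)) = normL 2 fun x => (solitonDeriv p ω x : ℂ) := by
    rw [normL, normL, eLpNorm_congr_ae (hasWeakDeriv_groundState hp ω).weakDeriv_ae_eq]
  rw [e, normL_two_sq]
  · simp
  · rw [memLp_two_iff_integrable_sq_norm hc]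
    simpa using integrable_solitonDeriv_sq hp hω

/-- By the Pohozaev identity the energy is `(1/2 - 2/(p-1)) ‖Q'‖² = s_c ‖Q'‖²`. -/
theorem energy_Q {p : ℝ} (hp : 1 < p) :
    energy p 0 (Q p) = sc p * ((p - 1) / (p + 3) * mass (Q p)) := by
  have h1 : p - 1 ≠ 0 := by linarith
  have h2 : p + 3 ≠ 0 := by linarith
  have h3 : p + 1 ≠ 0 := by linarith
  rw [energy, Q, normL_weakDeriv_groundState_sq hp one_pos, normL_groundState_rpow hp one_pos,
    mass_groundState hp one_pos, integral_solitonDeriv_sq hp one_pos,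
    integral_soliton_rpow hp one_pos, sc]
  field_simp
  ring

theorem normHdot_Q {p : ℝ} (hp : 1 < p) :
    normHdot 0 (Q p) = √((p - 1) / (p + 3) * mass (Q p)) := by
  rw [normHdot, Q, normL_weakDeriv_groundState_sq hp one_pos, mass_groundState hp one_pos,
    integral_solitonDeriv_sq hp one_pos]
  simp

/-! ### Removing the scale-invariant powers -/

/-- Here `M` and `m` are the masses of `f` and `Q`, and `r m = ‖Q'‖²`. The relation fixing `ω`
converts the power `2^(1/s)` and both mass powers into a single factor `ω`. -/
theorem le_of_mul_rpow_le {s r E M m ω : ℝ} (hs : 0 < s) (hM : 0 < M) (hm : 0 < m) (hω : 0 < ω)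
    (hmω : 2 * m = ω ^ s * M)
    (h : E * M ^ ((1 - s) / s) ≤ 2 ^ (1 / s) * (s * (r * m)) * m ^ ((1 - s) / s)) :
    E ≤ s * (r * ω * M) := by
  have hexp : 1 / s = 1 + (1 - s) / s := by field_simp; ring
  have h1 : ∀ t : ℝ, 0 < t → t ^ (1 / s) = t * t ^ ((1 - s) / s) := fun t ht => by
    rw [hexp, Real.rpow_add ht, Real.rpow_one]
  have h2 : 2 ^ (1 / s) * (m * m ^ ((1 - s) / s)) = ω * (M * M ^ ((1 - s) / s)) := by
    rw [← h1 m hm, ← h1 M hM, ← Real.mul_rpow two_pos.le hm.le, hmω,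
      Real.mul_rpow (by positivity) hM.le, ← Real.rpow_mul hω.le, mul_one_div_cancel hs.ne',
      Real.rpow_one]
  refine le_of_mul_le_mul_right (h.trans_eq ?_) (Real.rpow_pos_of_pos hM ((1 - s) / s))
  linear_combination s * r * h2

/-- Rewrites the threshold with the `L²` factor of `f` itself, so that this factor cancels in the
comparison. -/
theorem sqrt_two_mul_rpow_eq {s r M m ω : ℝ} (hr : 0 ≤ r) (hM : 0 < M) (hm : 0 < m)
    (hω : 0 < ω) (hmω : 2 * m = ω ^ s * M) :
    √2 * √m ^ (1 - s) * √(r * m) ^ s = √M ^ (1 - s) * √(r * ω * M) ^ s := by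
  have h1 : ∀ t : ℝ, 0 < t → √t ^ (1 - s) * √t ^ s = √t := fun t ht => by
    rw [← Real.rpow_add (Real.sqrt_pos.2 ht), sub_add_cancel, Real.rpow_one]
  have h2 : √2 * √m = √ω ^ s * √M := by
    rw [← Real.sqrt_mul two_pos.le, hmω, Real.sqrt_mul (by positivity), Real.sqrt_eq_rpow,
      Real.sqrt_eq_rpow ω, ← Real.rpow_mul hω.le, ← Real.rpow_mul hω.le, mul_comm s]
  rw [Real.sqrt_mul hr, Real.sqrt_mul (by positivity), Real.sqrt_mul hr,
    Real.mul_rpow (by positivity) (by positivity), Real.mul_rpow (by positivity) (by positivity),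
    Real.mul_rpow (by positivity) (by positivity)]
  calc √2 * √m ^ (1 - s) * (√r ^ s * √m ^ s) = √2 * (√m ^ (1 - s) * √m ^ s) * √r ^ s := by ring
    _ = √ω ^ s * (√M ^ (1 - s) * √M ^ s) * √r ^ s := by rw [h1 m hm, h1 M hM, h2]
    _ = _ := by ring

end DeltaNLS

/-! ### Proof of the main theorem -/

open DeltaNLS

theorem mainTheorem2 (p γ : ℝ) (hp : 5 < p) (hγ : γ < 0)
    (f : ℝ → ℂ) (hf : DeltaNLS.MemH1Even f)
    (hE : DeltaNLS.energy p γ f *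
        DeltaNLS.mass f ^ ((1 - DeltaNLS.sc p) / DeltaNLS.sc p) ≤
      (2 : ℝ) ^ (1 / DeltaNLS.sc p) * DeltaNLS.energy p 0 (DeltaNLS.Q p) *
        DeltaNLS.mass (DeltaNLS.Q p) ^ ((1 - DeltaNLS.sc p) / DeltaNLS.sc p))
    (hM : 2 * DeltaNLS.mass (DeltaNLS.groundState p (γ ^ 2 / 4)) ≤ DeltaNLS.mass f) :
    (0 < DeltaNLS.virial p γ f ↔
      DeltaNLS.normL 2 f ^ (1 - DeltaNLS.sc p) *
          DeltaNLS.normHdot γ f ^ DeltaNLS.sc p <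
        Real.sqrt 2 * DeltaNLS.normL 2 (DeltaNLS.Q p) ^ (1 - DeltaNLS.sc p) *
          DeltaNLS.normHdot 0 (DeltaNLS.Q p) ^ DeltaNLS.sc p) ∧
    (DeltaNLS.virial p γ f < 0 ↔
      Real.sqrt 2 * DeltaNLS.normL 2 (DeltaNLS.Q p) ^ (1 - DeltaNLS.sc p) *
          DeltaNLS.normHdot 0 (DeltaNLS.Q p) ^ DeltaNLS.sc p <
        DeltaNLS.normL 2 f ^ (1 - DeltaNLS.sc p) *
          DeltaNLS.normHdot γ f ^ DeltaNLS.sc p) := by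
  obtain ⟨hf1, heven⟩ := hf
  have hp1 : 1 < p := by linarith
  have hpm : 0 < p - 1 := by linarith
  have hp3 : 0 < p + 3 := by linarith
  have hs : 0 < sc p := by
    have : sc p = (p - 5) / (2 * (p - 1)) := by rw [sc]; field_simp; ring
    rw [this]
    have : 0 < p - 5 := by linarith
    positivity
  have hγ2 : 0 < γ ^ 2 / 4 := div_pos (sq_pos_of_neg hγ) (by norm_num)
  have hmQ : mass (Q p) = ∫ x, soliton p 1 x ^ 2 := mass_groundState hp1 one_pos
  have hm : 0 < mass (Q p) := hmQ ▸ integral_soliton_sq_pos hp1 one_pos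
  rw [mass_groundState hp1 hγ2, integral_soliton_sq_eq p hγ2, ← hmQ] at hM
  have hM0 : 0 < mass f := lt_of_lt_of_le
    (mul_pos two_pos (mul_pos (Real.rpow_pos_of_pos hγ2 _) hm)) hM
  have hMf : mass f = ∫ x, ‖f x‖ ^ 2 := normL_two_sq hf1.2.1
  -- the frequency `ω` for which `Q_{ω,0}` has half the mass of `f`
  obtain ⟨ω, hω, hmω⟩ : ∃ ω : ℝ, 0 < ω ∧ 2 * mass (Q p) = ω ^ sc p * mass f :=
    ⟨(2 * mass (Q p) / mass f) ^ (1 / sc p), by positivity, by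
      rw [← Real.rpow_mul (by positivity), one_div_mul_cancel hs.ne', Real.rpow_one,
        div_mul_cancel₀ _ hM0.ne']⟩
  -- The mass of `Q_{ω,0}` is proportional to `ω^(-s_c)`, hence decreasing in `ω`, so the mass
  -- hypothesis bounds `ω` by `γ²/4`.
  have hωγ : √ω ≤ -γ / 2 := by
    have h1 : ω ^ sc p ≤ (γ ^ 2 / 4) ^ sc p := by
      rw [Real.rpow_neg hγ2.le] at hM
      have h2 : 0 < (γ ^ 2 / 4) ^ sc p := by positivity
      refine le_of_mul_le_mul_right ?_ hM0
      rw [← hmω]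
      calc 2 * mass (Q p)
          = (γ ^ 2 / 4) ^ sc p * (2 * (((γ ^ 2 / 4) ^ sc p)⁻¹ * mass (Q p))) := by field_simp
        _ ≤ _ := mul_le_mul_of_nonneg_left hM h2.le
    have h2 := (Real.rpow_le_rpow_iff hω.le hγ2.le hs).1 h1
    refine Real.sqrt_le_iff.2 ⟨by linarith, h2.trans_eq ?_⟩
    ring
  have hmass : ∫ x, soliton p ω x ^ 2 = mass f / 2 := by
    have h1 : 0 < ω ^ sc p := by positivity
    rw [integral_soliton_sq_eq p hω, ← hmQ, Real.rpow_neg hω.le]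
    field_simp
    linarith
  have hI := hf1.incrementBound
  have hne : ∃ x, 0 < ‖f x‖ := by
    by_contra hcon
    push Not at hcon
    have : ∀ x, f x = 0 := fun x => norm_le_zero_iff.1 (hcon x)
    rw [hMf] at hM0
    simp [this] at hM0
  have heven' : ∀ x, ‖f (-x)‖ = ‖f x‖ := fun x => by rw [heven]
  have hD : normL 2 (weakDeriv f) ^ 2 = ∫ x, ‖weakDeriv f x‖ ^ 2 :=
    normL_two_sq hf1.memLp_weakDeriv
  have hN : normL (p + 1) f ^ (p + 1) = ∫ x, ‖f x‖ ^ (p + 1) :=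
    normL_rpow_self (by linarith) hf1.1.aestronglyMeasurable
      (hf1.integrable_norm_rpow heven hp1)
  rw [energy_Q hp1] at hE
  have hE' := le_of_mul_rpow_le hs hM0 hm hω hmω hE
  have hpos : 0 < normL 2 (weakDeriv f) ^ 2 + 2 * (-γ / 2) * ‖f 0‖ ^ 2 := by
    rw [hD]
    exact hI.energy_pos heven' hne (by linarith)
  have hD₀ : 0 < (p - 1) / (p + 3) * ω * mass f := by positivity
  have htri := virial_trichotomy (p := p) (D := normL 2 (weakDeriv f) ^ 2) (a := ‖f 0‖ ^ 2)
    (N := normL (p + 1) f ^ (p + 1)) (μ := -γ / 2) (D₀ := (p - 1) / (p + 3) * ω * mass f)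
    hp (by positivity) (by positivity) (Real.rpow_nonneg (normL_nonneg _ _) _) (by linarith) hpos
    (by
      rw [energy] at hE'
      refine le_trans (le_of_eq ?_) hE'
      ring)
    (fun l hl hlD => by
      have hNQ : 2 * ∫ x, soliton p ω x ^ (p + 1) =
          2 * (p + 1) / (p - 1) * ((p - 1) / (p + 3) * ω * mass f) := by
        rw [integral_soliton_rpow hp1 hω, hmass]
        field_simp
      -- By the Nehari identity, `D₀ + ω M(f)` is twice the `L^{p+1}` integral of the soliton, as
      -- the normalization requires.
      have h1 := hI.rpow_mul_integral_lt heven' hne hp1 hω hωγ hl (by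
        rw [← hD, hNQ, ← hMf, hlD]
        field_simp
        ring)
      rw [hNQ, ← hN] at h1
      exact h1)
    hD₀
  have hdot : normHdot γ f = √(normL 2 (weakDeriv f) ^ 2 + 2 * (-γ / 2) * ‖f 0‖ ^ 2) := by
    rw [normHdot, abs_of_neg hγ]
    congr 2
    ring
  have hvir : virial p γ f = normL 2 (weakDeriv f) ^ 2 + -γ / 2 * ‖f 0‖ ^ 2 -
      (p - 1) / (2 * (p + 1)) * normL (p + 1) f ^ (p + 1) := by
    rw [virial]
    ring
  have hcmp : ∀ x y : ℝ, 0 ≤ x → 0 ≤ y →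
      (√(mass f) ^ (1 - sc p) * √x ^ sc p < √(mass f) ^ (1 - sc p) * √y ^ sc p ↔ x < y) := by
    intro x y hx hy
    have hsM : 0 < √(mass f) := Real.sqrt_pos.2 hM0
    rw [mul_lt_mul_iff_right₀ (by positivity),
      Real.rpow_lt_rpow_iff (Real.sqrt_nonneg _) (Real.sqrt_nonneg _) hs,
      Real.sqrt_lt_sqrt_iff hx]
  rw [normHdot_Q hp1, normL_two_eq (Q p), normL_two_eq f,
    sqrt_two_mul_rpow_eq (by positivity) hM0 hm hω hmω, hdot, hvir, hcmp _ _ hpos.le hD₀.le,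
    hcmp _ _ hD₀.le hpos.le]
  obtain ⟨hne', hlt, hgt⟩ := htri
  -- The two strict cases have opposite virial signs and equality is excluded, which gives both
  -- converses.
  refine ⟨⟨fun h => ?_, hlt⟩, ⟨fun h => ?_, hgt⟩⟩
  · rcases lt_or_gt_of_ne hne' with h' | h'
    · exact h'
    · exact absurd h (hgt h').not_gt
  · rcases lt_or_gt_of_ne hne' with h' | h'
    · exact absurd h (hlt h').not_gt
    · exact h'
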